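/- Fix an alphabet $[d]$ with $d\ge 2$ and let $\{y_t\}$ be the output process of a stationary hidden Markov model (HMM) with $k\ge 1$ hidden states, all of positive stationary probability. Put $n=2\lceil\log_d k\rceil$ and $N=2n+1$. The joint probabilities of length-$N$ strings give the $d^n\times d^n$ matrices $H^{(0)}$ and $H^{(j)}$, $j\in[d]$: for strings $a,b\in[d]^n$, $$H^{(0)}_{a,b}=\mathbb P\big((y_{-1},\dots,y_{-n})=b,\ (y_0,\dots,y_{n-1})=a\big),\qquad H^{(j)}_{a,b}=\mathbb P\big((y_{-1},\dots,y_{-n})=b,\ y_0=j,\ (y_1,\dots,y_n)=a\big).$$ Let $\sigma_k$ be the $k$-th singular value of $H^{(0)}$ and assume $\sigma_k>0$. From $T$ independent samples of $(y_{-n},\dots,y_n)$ form $\widehat H^{(0)},\widehat H^{(j)}$ in the same way with the empirical probabilities in place of the exact ones. The realization algorithm of order $k$, given $H^{(0)},H^{(j)}$, takes the $k$ leading singular triples $U_H,D_H,V_H$ of a singular value decomposition of $H^{(0)}$, puts $U=U_HD_H^{1/2}$, $V=V_HD_H^{1/2}$, and returns $u=U^\top\mathbf e$, $v=V^\top\mathbf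 e$, $A^{(j)}=U^\dagger H^{(j)}(V^\dagger)^\top$ for $j\in[d]$, where $\mathbf e$ is the all-ones vector and $\dagger$ is the pseudo-inverse. Let $(\widetilde u,\widetilde v,\widetilde A^{(j)})$ and $(\widehat u,\widehat v,\widehat A^{(j)})$ be its outputs on the exact and on the empirical matrices, for any choice of the singular value decompositions. There is an absolute constant $C>0$ such that for all such $d$, $k$ and HMMs, all $0<\varepsilon\le 1$ and $\eta>0$, and every integer $$T\ \ge\ \frac{C\,k^6d^4}{\varepsilon^4\sigma_k^8}\,\log\!\Big(\frac{2k^4d^2}{\eta}\Big),$$ with probability at least $1-\eta$ the following holds: whatever singular value decompositions are used, there is an orthogonal matrix $R\in\mathbb R^{k\times k}$ with $$\|R^\top\widehat u-\widetilde u\|\le\varepsilon,\qquad \|R^{-1}\widehat v-\widetilde v\|\le\varepsilon,\qquad \|R^{-1}\widehat A^{(j)}R-\widetilde A^{(j)}\|\le\varepsilon\quad\text{for all } j\in[d],$$ in the Euclidean norm for vectors and the spectral norm for matrices. (That is, the empirical realization is $\varepsilon$-accurate as a quasi-HMM realization, after one orthogonal change to an equivalent realization.) -/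

import Mathlib

open MeasureTheory ProbabilityTheory
open scoped Matrix Matrix.Norms.L2Operator

/-- A stationary hidden Markov model with `k` hidden states and output alphabet `Fin d`:
`Q j i = P(x_{t+1} = j | x_t = i)`, `O l i = P(y_t = l | x_t = i)`, and `pi` is a stationary
distribution of the hidden chain, charging every state. -/
structure HMM (d k : ℕ) where
  Q : Matrix (Fin k) (Fin k) ℝ
  O : Matrix (Fin d) (Fin k) ℝ
  pi : Fin k → ℝ
  Q_nonneg : ∀ j i, 0 ≤ Q j i
  Q_sum : ∀ i, ∑ j, Q j i = 1
  O_nonneg : ∀ l i, 0 ≤ O l i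
  O_sum : ∀ i, ∑ l, O l i = 1
  pi_pos : ∀ i, 0 < pi i
  pi_sum : ∑ i, pi i = 1
  pi_stationary : Q *ᵥ pi = pi

/-- Strings of length `n` over the alphabet `Fin d`. -/
abbrev Word (d n : ℕ) : Type := Fin n → Fin d

/-- The joint probability that `m + 1` consecutive outputs spell the string `w`
(a sum over all paths of hidden states). -/
def HMM.wordProb {d k : ℕ} (M : HMM d k) {m : ℕ} (w : Word d (m + 1)) : ℝ :=
  ∑ x : Fin (m + 1) → Fin k,
    M.pi (x 0) * (∏ t : Fin m, M.Q (x t.succ) (x t.castSucc)) * ∏ t : Fin (m + 1), M.O (w t) (x t)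

/-- The table of the joint probabilities of the strings of length `2 n + 1`. -/
def HMM.table {d k : ℕ} (M : HMM d k) (n : ℕ) : Word d (2 * n + 1) → ℝ :=
  fun w => M.wordProb w

/-- A string `w` of length `2 n + 1` is read as `y_{-n}, …, y_n`. This is the position in `w`
of the time `-(m + 1)`. -/
def pastPos {n : ℕ} (m : Fin n) : Fin (2 * n + 1) := ⟨n - 1 - m, by omega⟩

/-- The position of the time `m`, where `0 ≤ m ≤ n`. -/
def futurePos {n : ℕ} (m : Fin (n + 1)) : Fin (2 * n + 1) := ⟨n + m, by omega⟩

/-- The matrix `H⁽⁰⁾` made from a table `p` of probabilities of the strings `y_{-n}, …, y_n`: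
the entry at `(a, b)` is the probability that `(y_0, …, y_{n-1}) = a` and
`(y_{-1}, …, y_{-n}) = b`. -/
def hankelZero {d n : ℕ} (p : Word d (2 * n + 1) → ℝ) : Matrix (Word d n) (Word d n) ℝ :=
  Matrix.of fun a b => ∑ w : Word d (2 * n + 1),
    if (∀ m : Fin n, w (pastPos m) = b m) ∧ (∀ m : Fin n, w (futurePos m.castSucc) = a m)
    then p w else 0

/-- The matrix `H⁽ʲ⁾` made from a table `p` of probabilities of the strings `y_{-n}, …, y_n`:
the entry at `(a, b)` is the probability that `(y_1, …, y_n) = a`, `y_0 = j` and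
`(y_{-1}, …, y_{-n}) = b`. -/
def hankel {d n : ℕ} (p : Word d (2 * n + 1) → ℝ) (j : Fin d) :
    Matrix (Word d n) (Word d n) ℝ :=
  Matrix.of fun a b => ∑ w : Word d (2 * n + 1),
    if (∀ m : Fin n, w (pastPos m) = b m) ∧ w (futurePos 0) = j ∧
      (∀ m : Fin n, w (futurePos m.succ) = a m)
    then p w else 0

/-- The empirical probabilities of the strings of length `N`, from `T` sample strings. -/
noncomputable def empirical {d N T : ℕ} (y : Fin T → Word d N) (w : Word d N) : ℝ :=
  (Fintype.card {i : Fin T // y i = w} : ℝ) / T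

/-- The `r`-th singular value of a square matrix, `r = 1, 2, …`, in decreasing order. -/
noncomputable def sigma {ι : Type*} [Fintype ι] [DecidableEq ι] (H : Matrix ι ι ℝ) (r : ℕ) : ℝ :=
  (Matrix.toEuclideanLin H).singularValues (r - 1)

/-- `H = P diag(s) Rᵀ` is a singular value decomposition of the square matrix `H`, with the
singular values in decreasing order. -/
structure IsSVD {ι : Type*} [Fintype ι] [DecidableEq ι] {N : ℕ} (H : Matrix ι ι ℝ)
    (P : Matrix ι (Fin N) ℝ) (s : Fin N → ℝ) (R : Matrix ι (Fin N) ℝ) : Prop where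
  left_orth : Pᵀ * P = 1
  left_orth' : P * Pᵀ = 1
  right_orth : Rᵀ * R = 1
  right_orth' : R * Rᵀ = 1
  nonneg : ∀ i, 0 ≤ s i
  antitone : Antitone s
  eq : H = P * Matrix.diagonal s * Rᵀ

/-- `B` is the Moore–Penrose pseudo-inverse of `A`. -/
structure IsPseudoInverse {ι κ : Type*} [Fintype ι] [Fintype κ]
    (A : Matrix ι κ ℝ) (B : Matrix κ ι ℝ) : Prop where
  aba : A * B * A = A
  bab : B * A * B = B
  ab_symm : (A * B)ᵀ = A * B
  ba_symm : (B * A)ᵀ = B * A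

/-- The parameters `(u, v, A⁽ʲ⁾ : j)` of a quasi-HMM of order `k`. -/
structure QuasiParams (d k : ℕ) where
  u : EuclideanSpace ℝ (Fin k)
  v : EuclideanSpace ℝ (Fin k)
  A : Fin d → Matrix (Fin k) (Fin k) ℝ

/-- The equivalent parameters after the change of basis `S` (a nonsingular matrix). -/
noncomputable def QuasiParams.changeBasis {d k : ℕ} (θ : QuasiParams d k)
    (S : Matrix (Fin k) (Fin k) ℝ) : QuasiParams d k where
  u := WithLp.toLp 2 (Sᵀ *ᵥ (θ.u : Fin k → ℝ))
  v := WithLp.toLp 2 (S⁻¹ *ᵥ (θ.v : Fin k → ℝ))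
  A := fun j => S⁻¹ * θ.A j * S

/-- `P D^{1/2}`, where `P` holds the `r` leading columns of the given `P` and `D` is the diagonal
matrix of the `r` leading values of `s`. -/
noncomputable def scaledFactor {ι : Type*} {N r : ℕ} (hr : r ≤ N)
    (P : Matrix ι (Fin N) ℝ) (s : Fin N → ℝ) : Matrix ι (Fin r) ℝ :=
  Matrix.of fun a i => P a (Fin.castLE hr i) * √(s (Fin.castLE hr i))

/-- `θ` is an output of order `r` of the spectral realization algorithm on input `H0`, `H j`:
for some singular value decomposition of `H0`, of which the `r` leading singular triples are kept,
`U = U_H D_H^{1/2}`, `V = V_H D_H^{1/2}`, `u = Uᵀ e`, `v = Vᵀ e`, `A⁽ʲ⁾ = U† H⁽ʲ⁾ (V†)ᵀ`. -/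
def IsAlgorithmOutput {d n r : ℕ} (H0 : Matrix (Word d n) (Word d n) ℝ)
    (H : Fin d → Matrix (Word d n) (Word d n) ℝ) (θ : QuasiParams d r) : Prop :=
  ∃ (hr : r ≤ d ^ n) (UH VH : Matrix (Word d n) (Fin (d ^ n)) ℝ) (s : Fin (d ^ n) → ℝ)
    (Ud Vd : Matrix (Fin r) (Word d n) ℝ),
    IsSVD H0 UH s VH ∧
    IsPseudoInverse (scaledFactor hr UH s) Ud ∧
    IsPseudoInverse (scaledFactor hr VH s) Vd ∧
    θ.u = WithLp.toLp 2 ((scaledFactor hr UH s)ᵀ *ᵥ fun _ => (1 : ℝ)) ∧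
    θ.v = WithLp.toLp 2 ((scaledFactor hr VH s)ᵀ *ᵥ fun _ => (1 : ℝ)) ∧
    ∀ j, θ.A j = Ud * H j * Vdᵀ

/-- The half window `n = 2 ⌈log_d k⌉`; strings have length `2 n + 1`. -/
noncomputable def halfWindow (d k : ℕ) : ℕ := 2 * ⌈Real.logb d k⌉₊

/-- Accuracy `ε` of `θ'` with respect to `θ`: Euclidean norm on vectors, spectral norm on
matrices. -/
def QuasiParams.Close {d k : ℕ} (ε : ℝ) (θ' θ : QuasiParams d k) : Prop :=
  ‖θ'.u - θ.u‖ ≤ ε ∧ ‖θ'.v - θ.v‖ ≤ ε ∧ ∀ j, ‖θ'.A j - θ.A j‖ ≤ ε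

/-! Past and future of the chain are independent given the hidden state at time 0, so `H⁽⁰⁾` factors
through the `k` hidden states and has rank at most `k`. Truncating its SVD at order `k` therefore
loses nothing: `H = U Vᵀ`, with `D = Uᵀ U = Vᵀ V ≥ σ`. What remains is a deterministic perturbation
bound and a concentration bound.

Balanced factors are determined only up to a rotation, and the leading singular values may coincide,
so singular vectors cannot be compared one by one. Put `X = U† U'` and `Y = V† V'`, where primes
denote the perturbed factors. A perturbation of size `δ` gives `X Yᵀ ≈ 1`, and the balance `U'ᵀ U' =
V'ᵀ V'` gives `Xᵀ D X ≈ Yᵀ D Y`. Hence `G = X Xᵀ` satisfies `G D G ≈ (X Yᵀ) D (X Yᵀ)ᵀ ≈ D`. Testing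
this on eigenvectors of `G` shows that its eigenvalues are near 1, so `X` is near its orthogonal
polar factor (`exists_orthogonal_near`). No gap between the leading singular values enters. One
rotation then brings both factors within `O(δ/σ²)` (`IsBalancedFactor.exists_rotation`), their
pseudo-inverses within `O(δ/σ³)`, and the parameters within `O(δ/σ⁴)`
(`IsBalancedFactor.exists_rotation_realization`).

The all-ones vector `e` is long, so `u` and `v` are read as `Uᵀ e = V† Hᵀ e` and `Vᵀ e = U† H e`,
where `H e` and `Hᵀ e` are vectors of marginal probabilities, of norm at most 1.

If every entry and every marginal deviates by at most `t`, then `δ = dⁿ t` is admissible, and `dⁿ ≤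
d² k²`. Hoeffding's inequality and a union bound over these events, with `t` of order `ε σ⁴ / dⁿ`,
give the sample size. -/

set_option linter.unusedSectionVars false

/-! ### Spectral norm of real matrices -/

section OperatorNorm

variable {ι κ τ : Type*} [Fintype ι] [DecidableEq ι] [Fintype κ] [DecidableEq κ]
  [Fintype τ] [DecidableEq τ]

theorem Matrix.l2_opNorm_transpose (A : Matrix ι κ ℝ) : ‖Aᵀ‖ = ‖A‖ := by
  rw [← Matrix.conjTranspose_eq_transpose_of_trivial, Matrix.l2_opNorm_conjTranspose]

theorem Matrix.l2_opNorm_transpose_mul_self (A : Matrix ι κ ℝ) : ‖Aᵀ * A‖ = ‖A‖ * ‖A‖ := by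
  rw [← Matrix.conjTranspose_eq_transpose_of_trivial, Matrix.l2_opNorm_conjTranspose_mul_self]

theorem Matrix.l2_opNorm_mul_transpose_self (A : Matrix ι κ ℝ) : ‖A * Aᵀ‖ = ‖A‖ * ‖A‖ := by
  have := Matrix.l2_opNorm_transpose_mul_self Aᵀ
  rwa [Matrix.transpose_transpose, Matrix.l2_opNorm_transpose] at this

theorem Matrix.l2_opNorm_one_le : ‖(1 : Matrix κ κ ℝ)‖ ≤ 1 := by
  rw [← Matrix.diagonal_one, Matrix.l2_opNorm_diagonal]
  exact (pi_norm_le_iff_of_nonneg zero_le_one).2 fun i => by simp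

theorem Matrix.l2_opNorm_le_one_of_transpose_mul_self {A : Matrix ι κ ℝ} (h : Aᵀ * A = 1) :
    ‖A‖ ≤ 1 := by
  have h1 := Matrix.l2_opNorm_transpose_mul_self A
  rw [h] at h1
  have h2 := Matrix.l2_opNorm_one_le (κ := κ)
  nlinarith [norm_nonneg A]

/-- A symmetric idempotent matrix has spectral norm at most one. -/
theorem Matrix.l2_opNorm_le_one_of_projection {A : Matrix κ κ ℝ} (hs : Aᵀ = A) (hi : A * A = A) :
    ‖A‖ ≤ 1 := by
  have h1 := Matrix.l2_opNorm_transpose_mul_self A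
  rw [hs, hi] at h1
  nlinarith [norm_nonneg A]

theorem Matrix.l2_opNorm_mul_le_of_le {A : Matrix ι κ ℝ} {B : Matrix κ τ ℝ} {a b : ℝ}
    (hA : ‖A‖ ≤ a) (hB : ‖B‖ ≤ b) : ‖A * B‖ ≤ a * b :=
  (Matrix.l2_opNorm_mul A B).trans
    (mul_le_mul hA hB (norm_nonneg _) ((norm_nonneg _).trans hA))

theorem Matrix.norm_toLp_mulVec_le (A : Matrix ι κ ℝ) (x : κ → ℝ) :
    ‖WithLp.toLp 2 (A *ᵥ x)‖ ≤ ‖A‖ * ‖WithLp.toLp 2 x‖ :=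
  Matrix.l2_opNorm_mulVec A (WithLp.toLp 2 x)

theorem Matrix.l2_opNorm_le_of_forall_mulVec {A : Matrix ι κ ℝ} {c : ℝ} (hc : 0 ≤ c)
    (h : ∀ x : κ → ℝ, ‖WithLp.toLp 2 (A *ᵥ x)‖ ≤ c * ‖WithLp.toLp 2 x‖) : ‖A‖ ≤ c := by
  rw [Matrix.l2_opNorm_def]
  exact ContinuousLinearMap.opNorm_le_bound _ hc fun x => h x.ofLp

theorem norm_toLp_sq (x : κ → ℝ) : ‖WithLp.toLp 2 x‖ ^ 2 = ∑ i, x i ^ 2 := by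
  simp [EuclideanSpace.norm_sq_eq]

theorem norm_toLp_sq_eq_dotProduct (x : κ → ℝ) : ‖WithLp.toLp 2 x‖ ^ 2 = x ⬝ᵥ x := by
  rw [norm_toLp_sq]; simp [dotProduct, sq]

theorem abs_dotProduct_le_norm (x y : κ → ℝ) :
    |x ⬝ᵥ y| ≤ ‖WithLp.toLp 2 x‖ * ‖WithLp.toLp 2 y‖ := by
  have h := abs_real_inner_le_norm (WithLp.toLp 2 x : EuclideanSpace ℝ κ) (WithLp.toLp 2 y)
  rwa [EuclideanSpace.inner_toLp_toLp, star_trivial, dotProduct_comm] at h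

theorem Matrix.abs_quadratic_le (A : Matrix κ κ ℝ) (x : κ → ℝ) :
    |x ⬝ᵥ (A *ᵥ x)| ≤ ‖A‖ * (x ⬝ᵥ x) := by
  have h := abs_dotProduct_le_norm x (A *ᵥ x)
  have h2 := Matrix.norm_toLp_mulVec_le A x
  rw [← norm_toLp_sq_eq_dotProduct]
  nlinarith [norm_nonneg (WithLp.toLp 2 x : EuclideanSpace ℝ κ)]

/-- The spectral norm is at most the Frobenius norm. -/
theorem Matrix.l2_opNorm_le_of_sum_sq_le {A : Matrix ι κ ℝ} {c : ℝ} (hc : 0 ≤ c)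
    (h : ∑ i, ∑ j, A i j ^ 2 ≤ c ^ 2) : ‖A‖ ≤ c := by
  refine Matrix.l2_opNorm_le_of_forall_mulVec hc fun x => ?_
  refine le_of_sq_le_sq ?_ (by positivity)
  rw [mul_pow, norm_toLp_sq, norm_toLp_sq]
  calc ∑ i, (A *ᵥ x) i ^ 2 ≤ ∑ i, (∑ j, A i j ^ 2) * ∑ j, x j ^ 2 :=
        Finset.sum_le_sum fun i _ => Finset.sum_mul_sq_le_sq_mul_sq _ _ _
    _ = (∑ i, ∑ j, A i j ^ 2) * ∑ j, x j ^ 2 := by rw [Finset.sum_mul]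
    _ ≤ _ := by gcongr

end OperatorNorm

/-! ### Closeness to the orthogonal polar factor -/

/-- If `M Mᵀ` nearly preserves a positive definite form by congruence, then `M` is
nearly orthogonal. -/
theorem exists_orthogonal_near {κ : Type*} [Fintype κ] [DecidableEq κ] (M D : Matrix κ κ ℝ)
    {σ β : ℝ} (hσ : 0 < σ) (hβ : β < 1) (hD : ∀ x : κ → ℝ, σ * (x ⬝ᵥ x) ≤ x ⬝ᵥ (D *ᵥ x))
    (h : ‖M * Mᵀ * D * (M * Mᵀ) - D‖ ≤ β * σ) :
    ∃ R ∈ Matrix.orthogonalGroup κ ℝ, ‖M - R‖ ≤ β := by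
  have hβ0 : 0 ≤ β := nonneg_of_mul_nonneg_left ((norm_nonneg _).trans h) hσ
  set G := M * Mᵀ with hGdef
  have hP : G.PosSemidef := by
    have := Matrix.posSemidef_self_mul_conjTranspose M
    rwa [Matrix.conjTranspose_eq_transpose_of_trivial] at this
  have hG : G.IsHermitian := hP.1
  have hGt : Gᵀ = G := by simp [hGdef]
  have hev0 : ∀ i, 0 ≤ hG.eigenvalues i := hP.eigenvalues_nonneg
  -- At a unit eigenvector `x` with eigenvalue `l`, the form of `G D G - D` equals `(l² - 1) xᵀ D
  -- x`, and `xᵀ D x ≥ σ` cancels the `σ` of the hypothesis.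
  have hev : ∀ i, |hG.eigenvalues i ^ 2 - 1| ≤ β := by
    intro i
    set l := hG.eigenvalues i
    let x : κ → ℝ := (hG.eigenvectorBasis i).ofLp
    have hx : x ⬝ᵥ x = 1 := by
      rw [← norm_toLp_sq_eq_dotProduct]
      have : ‖hG.eigenvectorBasis i‖ = 1 := hG.eigenvectorBasis.orthonormal.1 i
      simp [x, this]
    have hGx : G *ᵥ x = l • x := hG.mulVec_eigenvectorBasis i
    have hxG : x ᵥ* G = l • x := by
      rw [← hGx, ← hGt, Matrix.vecMul_transpose, hGt]
    have e : x ⬝ᵥ ((G * D * G - D) *ᵥ x) = (l ^ 2 - 1) * (x ⬝ᵥ (D *ᵥ x)) := by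
      rw [Matrix.sub_mulVec, dotProduct_sub, ← Matrix.mulVec_mulVec, hGx, ← Matrix.mulVec_mulVec,
        Matrix.mulVec_smul, Matrix.mulVec_smul, dotProduct_smul, Matrix.dotProduct_mulVec, hxG,
        smul_dotProduct]
      simp only [smul_eq_mul]; ring
    have h1 := Matrix.abs_quadratic_le (G * D * G - D) x
    rw [e, hx, mul_one, abs_mul] at h1
    have h2 := hD x
    rw [hx, mul_one] at h2
    have h3 := le_abs_self (x ⬝ᵥ (D *ᵥ x))
    have h4 : |l ^ 2 - 1| * σ ≤ β * σ :=
      (mul_le_mul_of_nonneg_left (h2.trans h3) (abs_nonneg _)).trans (h1.trans h)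
    exact le_of_mul_le_mul_right h4 hσ
  have hpos : ∀ i, 0 < hG.eigenvalues i := by
    intro i
    rcases (hev0 i).lt_or_eq with h | h
    · exact h
    · have := hev i
      rw [← h] at this
      norm_num at this
      linarith
  set Q : Matrix κ κ ℝ := (hG.eigenvectorUnitary : Matrix κ κ ℝ)
  have hQ1 : Qᵀ * Q = 1 := by
    have := Unitary.coe_star_mul_self hG.eigenvectorUnitary
    rwa [Matrix.star_eq_conjTranspose, Matrix.conjTranspose_eq_transpose_of_trivial] at this
  have hQ2 : Q * Qᵀ = 1 := mul_eq_one_comm.1 hQ1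
  have hGQ : G = Q * Matrix.diagonal hG.eigenvalues * Qᵀ := by
    have := hG.spectral_theorem
    rw [Unitary.conjStarAlgAut_apply, Matrix.star_eq_conjTranspose,
      Matrix.conjTranspose_eq_transpose_of_trivial] at this
    exact this
  set S := Matrix.diagonal (fun i => √(hG.eigenvalues i))
  set Si := Matrix.diagonal (fun i => (√(hG.eigenvalues i))⁻¹)
  have hs : ∀ i, √(hG.eigenvalues i) ≠ 0 := fun i => (Real.sqrt_pos.2 (hpos i)).ne'
  have hSSi : S * Si = 1 := by
    simp only [S, Si, Matrix.diagonal_mul_diagonal]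
    rw [← Matrix.diagonal_one]; congr 1; ext i; exact mul_inv_cancel₀ (hs i)
  have hSiS : Si * S = 1 := mul_eq_one_comm.1 hSSi
  have hSS : Matrix.diagonal hG.eigenvalues = S * S := by
    simp only [S, Matrix.diagonal_mul_diagonal]
    congr 1; ext i; exact (Real.mul_self_sqrt (hev0 i)).symm
  have hSit : Siᵀ = Si := Matrix.diagonal_transpose _
  -- The polar factor `G^{-1/2} M`; then `M - R = (G^{1/2} - 1) R`.
  set R := Q * Si * Qᵀ * M
  have hRR : R * Rᵀ = 1 := by
    have : R * Rᵀ = Q * Si * Qᵀ * G * (Q * Si * Qᵀ) := by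
      simp only [R, hGdef, Matrix.transpose_mul, Matrix.transpose_transpose, hSit,
        Matrix.mul_assoc]
    rw [this, hGQ, hSS]
    calc Q * Si * Qᵀ * (Q * (S * S) * Qᵀ) * (Q * Si * Qᵀ)
        = Q * (Si * (Qᵀ * Q) * S) * (S * (Qᵀ * Q) * Si) * Qᵀ := by simp only [Matrix.mul_assoc]
      _ = 1 := by rw [hQ1, Matrix.mul_one, Matrix.mul_one, hSiS, hSSi, Matrix.mul_one,
        Matrix.mul_one, hQ2]
  have hRtR : Rᵀ * R = 1 := mul_eq_one_comm.1 hRR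
  refine ⟨R, ?_, ?_⟩
  · rw [Matrix.mem_orthogonalGroup_iff]
    exact hRR
  · have hM : M - R = Q * (S - 1) * Qᵀ * R := by
      have h1 : Q * S * Qᵀ * R = M := by
        calc Q * S * Qᵀ * R = Q * (S * (Qᵀ * Q) * Si) * Qᵀ * M := by
              simp only [R, Matrix.mul_assoc]
          _ = M := by rw [hQ1, Matrix.mul_one, hSSi, Matrix.mul_one, hQ2, Matrix.one_mul]
      rw [Matrix.mul_sub, Matrix.sub_mul, Matrix.sub_mul, h1, Matrix.mul_one, hQ2, Matrix.one_mul]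
    have hS1 : ‖S - 1‖ ≤ β := by
      rw [← Matrix.diagonal_one, Matrix.diagonal_sub, Matrix.l2_opNorm_diagonal]
      refine (pi_norm_le_iff_of_nonneg hβ0).2 fun i => ?_
      refine le_trans ?_ (hev i)
      rw [Real.norm_eq_abs]
      set r := √(hG.eigenvalues i)
      have hr : hG.eigenvalues i = r ^ 2 := (Real.sq_sqrt (hev0 i)).symm
      have hr0 : 0 ≤ r := Real.sqrt_nonneg _
      rw [hr, show (r ^ 2) ^ 2 - 1 = (r - 1) * ((r + 1) * (r ^ 2 + 1)) by ring, abs_mul]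
      refine le_mul_of_one_le_right (abs_nonneg _) ?_
      rw [abs_of_nonneg (by positivity)]
      nlinarith [sq_nonneg r]
    have hQn := Matrix.l2_opNorm_le_one_of_transpose_mul_self hQ1
    have hRn := Matrix.l2_opNorm_le_one_of_transpose_mul_self hRtR
    rw [hM]
    have h1 := Matrix.l2_opNorm_mul_le_of_le (Matrix.l2_opNorm_mul_le_of_le
      (Matrix.l2_opNorm_mul_le_of_le hQn hS1) ((Matrix.l2_opNorm_transpose Q).trans_le hQn)) hRn
    linarith

/-! ### Perturbation of balanced factors -/

/-- `U`, `V`, with left inverses `Ud`, `Vd`, are the balanced factors of a truncated singular value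
decomposition of `H`. -/
structure IsBalancedFactor {ι κ : Type*} [Fintype ι] [Fintype κ] [DecidableEq κ]
    (H : Matrix ι ι ℝ) (U V : Matrix ι κ ℝ) (Ud Vd : Matrix κ ι ℝ) : Prop where
  left_inv : Ud * U = 1
  left_symm : (U * Ud)ᵀ = U * Ud
  right_inv : Vd * V = 1
  right_symm : (V * Vd)ᵀ = V * Vd
  left_eq : Vd * Hᵀ = Uᵀ
  right_eq : Ud * H = Vᵀ
  gram : Uᵀ * U = Vᵀ * V

namespace IsBalancedFactor

variable {ι κ : Type*} [Fintype ι] [DecidableEq ι] [Fintype κ] [DecidableEq κ]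
  {H H' : Matrix ι ι ℝ} {U V U' V' : Matrix ι κ ℝ} {Ud Vd Ud' Vd' : Matrix κ ι ℝ}

theorem swap (B : IsBalancedFactor H U V Ud Vd) : IsBalancedFactor Hᵀ V U Vd Ud where
  left_inv := B.right_inv
  left_symm := B.right_symm
  right_inv := B.left_inv
  right_symm := B.left_symm
  left_eq := by rw [Matrix.transpose_transpose, B.right_eq]
  right_eq := B.left_eq
  gram := B.gram.symm

/-- Rotation destroys the diagonal form of the Gram matrices but not their equality, which is why
`gram` asks for no more. -/
theorem rotate (B : IsBalancedFactor H U V Ud Vd) {R : Matrix κ κ ℝ} (hR : R * Rᵀ = 1) :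
    IsBalancedFactor H (U * R) (V * R) (Rᵀ * Ud) (Rᵀ * Vd) := by
  have hR' : Rᵀ * R = 1 := mul_eq_one_comm.1 hR
  have key : ∀ (A : Matrix ι κ ℝ) (C : Matrix κ ι ℝ), A * R * (Rᵀ * C) = A * C := fun A C => by
    rw [Matrix.mul_assoc, ← Matrix.mul_assoc R, hR, Matrix.one_mul]
  have key' : ∀ (A : Matrix ι κ ℝ) (C : Matrix κ ι ℝ), C * A = 1 → Rᵀ * C * (A * R) = 1 :=
    fun A C h => by
      rw [Matrix.mul_assoc, ← Matrix.mul_assoc C, h, Matrix.one_mul, hR']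
  refine ⟨key' _ _ B.left_inv, ?_, key' _ _ B.right_inv, ?_, ?_, ?_, ?_⟩
  · rw [key, B.left_symm]
  · rw [key, B.right_symm]
  · rw [Matrix.mul_assoc, B.left_eq, Matrix.transpose_mul]
  · rw [Matrix.mul_assoc, B.right_eq, Matrix.transpose_mul]
  · rw [Matrix.transpose_mul, Matrix.transpose_mul, Matrix.mul_assoc, Matrix.mul_assoc,
      ← Matrix.mul_assoc Uᵀ, ← Matrix.mul_assoc Vᵀ, B.gram]

theorem left_factor (B : IsBalancedFactor H U V Ud Vd) : H * Vdᵀ = U := by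
  have := congrArg Matrix.transpose B.left_eq
  simpa using this

theorem left_pinv_eq (B : IsBalancedFactor H U V Ud Vd) : Ud * Udᵀ * Uᵀ = Ud := by
  rw [Matrix.mul_assoc, ← Matrix.transpose_mul, B.left_symm, ← Matrix.mul_assoc, B.left_inv,
    Matrix.one_mul]

/-- Balance gives `Uᵀ H V = D²` for the common Gram matrix `D`, whence `‖D‖² ≤ ‖U‖ ‖H‖ ‖V‖ = ‖D‖
‖H‖`. The identity `H = U Vᵀ` is not needed, so truncated factors are covered. -/
theorem norm_sq_left_le (B : IsBalancedFactor H U V Ud Vd) : ‖U‖ ^ 2 ≤ ‖H‖ := by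
  set D := Uᵀ * U with hD
  have hV : Vdᵀ * D = V := by
    rw [hD, B.gram, ← Matrix.mul_assoc, ← Matrix.transpose_mul, B.right_symm, Matrix.mul_assoc,
      B.right_inv, Matrix.mul_one]
  have h1 : Uᵀ * H * V = D * D := by
    rw [← hV, ← Matrix.mul_assoc, Matrix.mul_assoc Uᵀ H, B.left_factor]
  have hDt : Dᵀ = D := by simp [hD]
  have h2 : ‖D‖ * ‖D‖ = ‖Uᵀ * H * V‖ := by
    rw [h1, ← Matrix.l2_opNorm_transpose_mul_self, hDt]
  have hUD : ‖D‖ = ‖U‖ * ‖U‖ := Matrix.l2_opNorm_transpose_mul_self U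
  have hVD : ‖D‖ = ‖V‖ * ‖V‖ := by rw [hD, B.gram, Matrix.l2_opNorm_transpose_mul_self V]
  have h3 : ‖Uᵀ * H * V‖ ≤ ‖U‖ * ‖H‖ * ‖V‖ :=
    Matrix.l2_opNorm_mul_le_of_le (Matrix.l2_opNorm_mul_le_of_le
      (Matrix.l2_opNorm_transpose U).le le_rfl) le_rfl
  have hUV : ‖V‖ = ‖U‖ := by
    exact ((mul_self_inj_of_nonneg (norm_nonneg U) (norm_nonneg V)).1 (hUD.symm.trans hVD)).symm
  rw [← h2, hUD, hUV] at h3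
  rcases (norm_nonneg U).eq_or_lt with h0 | h0
  · rw [← h0]; simp
  · have : 0 < ‖U‖ * ‖U‖ := by positivity
    nlinarith

theorem norm_left_le_one (B : IsBalancedFactor H U V Ud Vd) (hH : ‖H‖ ≤ 1) : ‖U‖ ≤ 1 := by
  have := B.norm_sq_left_le
  nlinarith [norm_nonneg U]

theorem norm_one_sub_le (B : IsBalancedFactor H U V Ud Vd) : ‖1 - U * Ud‖ ≤ 1 := by
  apply Matrix.l2_opNorm_le_one_of_projection
  · rw [Matrix.transpose_sub, B.left_symm, Matrix.transpose_one]
  · have : U * Ud * (U * Ud) = U * Ud := by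
      rw [Matrix.mul_assoc, ← Matrix.mul_assoc Ud, B.left_inv, Matrix.one_mul]
    rw [Matrix.sub_mul, Matrix.mul_sub (U * Ud), Matrix.one_mul, Matrix.mul_one, this]
    simp

/-- The part of the perturbed left factor outside the exact column space. -/
theorem norm_left_residual_le (B : IsBalancedFactor H U V Ud Vd)
    (B' : IsBalancedFactor H' U' V' Ud' Vd') (hH : H = U * Vᵀ) {δ a : ℝ}
    (hδ : ‖H' - H‖ ≤ δ) (ha : ‖Vd'‖ ≤ a) : ‖U' - U * (Ud * U')‖ ≤ δ * a := by
  -- The projection `1 - U Ud` kills `H`, and `U' = H' Vd'ᵀ`, so only `H' - H` survives.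
  have h0 : (1 - U * Ud) * H = 0 := by
    rw [Matrix.sub_mul, Matrix.one_mul, Matrix.mul_assoc, B.right_eq, ← hH, sub_self]
  have h1 : U' - U * (Ud * U') = (1 - U * Ud) * ((H' - H) * Vd'ᵀ) := by
    rw [Matrix.sub_mul H', Matrix.mul_sub, B'.left_factor, ← Matrix.mul_assoc _ H, h0,
      Matrix.zero_mul, sub_zero, Matrix.sub_mul, Matrix.one_mul, Matrix.mul_assoc]
  rw [h1]
  have := Matrix.l2_opNorm_mul_le_of_le B.norm_one_sub_le
    (Matrix.l2_opNorm_mul_le_of_le hδ ((Matrix.l2_opNorm_transpose Vd').trans_le ha))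
  linarith

/-- Pythagoras: the residual is orthogonal to the columns of `U`, so it enters the Gram matrix only
quadratically. -/
theorem gram_residual (B : IsBalancedFactor H U V Ud Vd) :
    (Ud * U')ᵀ * (Uᵀ * U) * (Ud * U')
      = U'ᵀ * U' - (U' - U * (Ud * U'))ᵀ * (U' - U * (Ud * U')) := by
  have h1 : Uᵀ * (U' - U * (Ud * U')) = 0 := by
    have : Uᵀ * (U * Ud) = Uᵀ := by
      rw [← B.left_symm, ← Matrix.transpose_mul, Matrix.mul_assoc, B.left_inv, Matrix.mul_one]
    rw [Matrix.mul_sub, ← Matrix.mul_assoc U, ← Matrix.mul_assoc, this, sub_self]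
  set E := U' - U * (Ud * U') with hE
  have h2 : Eᵀ * U = 0 := by
    have := congrArg Matrix.transpose h1
    simpa using this
  have h3 : U' = U * (Ud * U') + E := by rw [hE]; abel
  set X := Ud * U'
  have h4 : U'ᵀ * U' = Xᵀ * (Uᵀ * U) * X + Eᵀ * E := by
    rw [h3, Matrix.transpose_add, Matrix.add_mul, Matrix.mul_add, Matrix.mul_add,
      Matrix.transpose_mul, ← Matrix.mul_assoc Eᵀ, h2, Matrix.mul_assoc Xᵀ Uᵀ E, h1]
    simp [Matrix.mul_assoc]
  rw [h4, add_sub_cancel_right]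

theorem right_factor_eq (B : IsBalancedFactor H U V Ud Vd) (W : Matrix ι ι ℝ) :
    Ud * W * Vdᵀ - 1 = Ud * (W - H) * Vdᵀ := by
  have : Ud * H * Vdᵀ = 1 := by
    rw [B.right_eq, ← Matrix.transpose_mul, B.right_inv, Matrix.transpose_one]
  rw [Matrix.mul_sub, Matrix.sub_mul, this]

set_option maxHeartbeats 1000000 in
/-- Perturbation of the balanced factors of a matrix of exact rank: after one rotation, both
perturbed factors are close to the exact ones. -/
theorem exists_rotation (B : IsBalancedFactor H U V Ud Vd)
    (B' : IsBalancedFactor H' U' V' Ud' Vd') (hH : H = U * Vᵀ) {δ σ a : ℝ}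
    (hσ : 0 < σ) (hσ1 : σ ≤ 1) (hδ1 : δ ≤ σ ^ 2 / 100) (ha2 : a ^ 2 = 2 / σ) (ha0 : 0 ≤ a)
    (hUd : ‖Ud‖ ≤ a) (hVd : ‖Vd‖ ≤ a) (hUd' : ‖Ud'‖ ≤ a) (hVd' : ‖Vd'‖ ≤ a)
    (hH1 : ‖H‖ ≤ 1) (hH1' : ‖H'‖ ≤ 1) (hδ : ‖H' - H‖ ≤ δ) (hres : ‖H' - U' * V'ᵀ‖ ≤ δ)
    (hD : ∀ x : κ → ℝ, σ * (x ⬝ᵥ x) ≤ x ⬝ᵥ ((Uᵀ * U) *ᵥ x)) :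
    ∃ R ∈ Matrix.orthogonalGroup κ ℝ,
      ‖U' * R - U‖ ≤ 36 * δ / σ ^ 2 ∧ ‖V' * R - V‖ ≤ 36 * δ / σ ^ 2 := by
  have hδ0 : 0 ≤ δ := (norm_nonneg _).trans hδ
  have hU := B.norm_left_le_one hH1
  have hV := B.swap.norm_left_le_one ((Matrix.l2_opNorm_transpose H).trans_le hH1)
  have hU' := B'.norm_left_le_one hH1'
  have hE1 := B.norm_left_residual_le B' hH hδ hVd'
  have hδt : ‖H'ᵀ - Hᵀ‖ ≤ δ := by
    rwa [← Matrix.transpose_sub, Matrix.l2_opNorm_transpose]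
  have hE2 := B.swap.norm_left_residual_le B'.swap (by rw [hH]; simp)
    hδt hUd'
  have hg1 := B.gram_residual (U' := U')
  have hg2 := B.swap.gram_residual (U' := V')
  rw [← B.gram, ← B'.gram] at hg2
  set X := Ud * U'
  set Y := Vd * V'
  set E := U' - U * X with hE
  set F := V' - V * Y with hF
  set D := Uᵀ * U with hDdef
  -- The perturbation and the truncation error contribute `δ` each, the two pseudo-inverses `a² =
  -- 2/σ`.
  have hK : ‖X * Yᵀ - 1‖ ≤ 4 * δ / σ := by
    have h1 : X * Yᵀ - 1 = Ud * (U' * V'ᵀ - H) * Vdᵀ := by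
      rw [← B.right_factor_eq]
      simp only [X, Y, Matrix.transpose_mul, Matrix.mul_assoc]
    have h2 : ‖U' * V'ᵀ - H‖ ≤ 2 * δ := by
      have : U' * V'ᵀ - H = (H' - H) - (H' - U' * V'ᵀ) := by abel
      rw [this]
      exact (norm_sub_le _ _).trans (by linarith)
    rw [h1]
    refine (Matrix.l2_opNorm_mul_le_of_le (Matrix.l2_opNorm_mul_le_of_le hUd h2)
      ((Matrix.l2_opNorm_transpose Vd).trans_le hVd)).trans (le_of_eq ?_)
    rw [show a * (2 * δ) * a = a ^ 2 * (2 * δ) by ring, ha2]; ring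
  set K := X * Yᵀ - 1 with hKdef
  have hXY : X * Yᵀ = 1 + K := by rw [hKdef]; abel
  have hXn : ‖X‖ ≤ a := by
    simpa using Matrix.l2_opNorm_mul_le_of_le hUd hU'
  have hDn : ‖D‖ ≤ 1 := by
    rw [hDdef, Matrix.l2_opNorm_transpose_mul_self]
    exact mul_le_one₀ hU (norm_nonneg _) hU
  -- Equality of the perturbed Gram matrices exchanges `Xᵀ D X` for `Yᵀ D Y` up to the residuals;
  -- then `X Yᵀ = 1 + K` is substituted.
  have hcong : X * Xᵀ * D * (X * Xᵀ) - D
      = K * D + D * Kᵀ + K * D * Kᵀ + X * (Fᵀ * F - Eᵀ * E) * Xᵀ := by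
    have h1 : Xᵀ * D * X = Yᵀ * D * Y + (Fᵀ * F - Eᵀ * E) := by rw [hg1, hg2]; abel
    have h2 : X * Xᵀ * D * (X * Xᵀ) = X * (Xᵀ * D * X) * Xᵀ := by simp only [Matrix.mul_assoc]
    have h3 : X * (Yᵀ * D * Y) * Xᵀ = (X * Yᵀ) * D * (X * Yᵀ)ᵀ := by
      simp only [Matrix.transpose_mul, Matrix.transpose_transpose, Matrix.mul_assoc]
    rw [h2, h1, Matrix.mul_add, Matrix.add_mul, h3, hXY, Matrix.transpose_add,
      Matrix.transpose_one]
    simp only [Matrix.add_mul, Matrix.mul_add, Matrix.one_mul, Matrix.mul_one]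
    abel
  have hf1 : 4 * δ / σ ≤ 1 := by rw [div_le_one hσ]; nlinarith
  have hKt : ‖Kᵀ‖ ≤ 4 * δ / σ := (Matrix.l2_opNorm_transpose K).trans_le hK
  set f := 4 * δ / σ with hf
  have hf0 : 0 ≤ f := by positivity
  have hEE : ‖Fᵀ * F - Eᵀ * E‖ ≤ 2 * (δ * a) ^ 2 := by
    refine (norm_sub_le _ _).trans ?_
    rw [Matrix.l2_opNorm_transpose_mul_self, Matrix.l2_opNorm_transpose_mul_self]
    have := mul_le_mul hE1 hE1 (norm_nonneg _) (by positivity)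
    have := mul_le_mul hE2 hE2 (norm_nonneg _) (by positivity)
    linarith
  -- The three terms with `K` are at most `4δ/σ` each and the residual term at most `δ/σ`, in total
  -- `13δ/σ = β σ`.
  set β := 13 * δ / σ ^ 2 with hβ
  have hβ1 : β ≤ 1 / 2 := by
    rw [hβ, div_le_iff₀ (by positivity)]; linarith
  have hβ0 : 0 ≤ β := by positivity
  have hbound : ‖X * Xᵀ * D * (X * Xᵀ) - D‖ ≤ β * σ := by
    rw [hcong]
    have n1 := Matrix.l2_opNorm_mul_le_of_le hK hDn
    have n2 := Matrix.l2_opNorm_mul_le_of_le hDn hKt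
    have n3 := Matrix.l2_opNorm_mul_le_of_le n1 hKt
    have n4 := Matrix.l2_opNorm_mul_le_of_le (Matrix.l2_opNorm_mul_le_of_le hXn hEE)
      ((Matrix.l2_opNorm_transpose X).trans_le hXn)
    have n5 : a * (2 * (δ * a) ^ 2) * a ≤ δ / σ := by
      rw [show a * (2 * (δ * a) ^ 2) * a = 2 * δ ^ 2 * (a ^ 2) ^ 2 by ring, ha2,
        show 2 * δ ^ 2 * (2 / σ) ^ 2 = (8 * δ / σ) * (δ / σ) by field_simp; ring]
      refine mul_le_of_le_one_left (by positivity) ?_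
      rw [div_le_one hσ]; nlinarith
    have n6 : β * σ = 3 * f + δ / σ := by rw [hβ, hf]; field_simp; ring
    rw [n6]
    refine (norm_add_le _ _).trans ?_
    have := (norm_add₃_le (a := K * D) (b := D * Kᵀ) (c := K * D * Kᵀ))
    have hff : f * 1 * f ≤ f := by
      rw [mul_one]; exact mul_le_of_le_one_left hf0 hf1
    clear_value X Y E F D K f β
    linarith
  obtain ⟨R, hR, hXR⟩ := exists_orthogonal_near X D hσ (by linarith) hD hbound
  have hRR : R * Rᵀ = 1 := (Matrix.mem_orthogonalGroup_iff _ _).1 hR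
  have hRtR : Rᵀ * R = 1 := mul_eq_one_comm.1 hRR
  have hRn : ‖R‖ ≤ 1 := Matrix.l2_opNorm_le_one_of_transpose_mul_self hRtR
  have hRtn : ‖Rᵀ‖ ≤ 1 := (Matrix.l2_opNorm_transpose R).trans_le hRn
  have haδ : δ * a ≤ 2 * δ / σ ^ 2 := by
    have : a ≤ 2 / σ ^ 2 := by
      refine le_of_sq_le_sq ?_ (by positivity)
      rw [ha2, div_pow, div_le_div_iff₀ hσ (by positivity)]
      have := mul_le_mul_of_nonneg_left (pow_le_one₀ hσ.le hσ1 : σ ^ 3 ≤ 1) hσ.le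
      linarith
    calc δ * a ≤ δ * (2 / σ ^ 2) := by gcongr
      _ = _ := by ring
  have hfβ : f ≤ 4 * δ / σ ^ 2 := by
    rw [hf]; gcongr; exact pow_le_of_le_one hσ.le hσ1 two_ne_zero
  -- `X ≈ R` means `U' ≈ U R`, so the transpose undoes the rotation.
  refine ⟨Rᵀ, ?_, ?_, ?_⟩
  · rw [Matrix.mem_orthogonalGroup_iff]
    change Rᵀ * Rᵀᵀ = 1
    rw [Matrix.transpose_transpose, hRtR]
  · have h1 : U' * Rᵀ - U = U * ((X - R) * Rᵀ) + E * Rᵀ := by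
      rw [Matrix.sub_mul, hRR, hE, Matrix.sub_mul, Matrix.mul_sub, Matrix.mul_one]
      simp only [Matrix.mul_assoc]; abel
    have n1 := Matrix.l2_opNorm_mul_le_of_le hU (Matrix.l2_opNorm_mul_le_of_le hXR hRtn)
    have n2 := Matrix.l2_opNorm_mul_le_of_le hE1 hRtn
    rw [h1]
    refine (norm_add_le _ _).trans ?_
    have : 36 * δ / σ ^ 2 = β + 2 * δ / σ ^ 2 + 21 * (δ / σ ^ 2) := by rw [hβ]; ring
    have : 0 ≤ δ / σ ^ 2 := by positivity
    linarith
  -- The same rotation serves the right factor, since `R Yᵀ ≈ X Yᵀ ≈ 1`. The bound on `‖Y‖` involves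
  -- the quantity being estimated, which `β ≤ 1/2` absorbs.
  · have hx : ‖Y * Rᵀ - 1‖ ≤ 2 * (f + β) := by
      have h1 : (Y * Rᵀ - 1)ᵀ = K - (X - R) * Yᵀ := by
        rw [Matrix.transpose_sub, Matrix.transpose_mul, Matrix.transpose_transpose,
          Matrix.transpose_one, Matrix.sub_mul, hXY]; abel
      have h2 : ‖Y‖ ≤ 1 + ‖Y * Rᵀ - 1‖ := by
        have : Y = (1 + (Y * Rᵀ - 1)) * R := by
          rw [add_sub_cancel, Matrix.mul_assoc, hRtR, Matrix.mul_one]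
        have n1 : ‖1 + (Y * Rᵀ - 1)‖ ≤ 1 + ‖Y * Rᵀ - 1‖ :=
          (norm_add_le _ _).trans (by linarith [Matrix.l2_opNorm_one_le (κ := κ)])
        have n2 := Matrix.l2_opNorm_mul_le_of_le n1 hRn
        rw [← this] at n2
        linarith
      have h3 : ‖Y * Rᵀ - 1‖ ≤ f + β * (1 + ‖Y * Rᵀ - 1‖) := by
        refine (((Matrix.l2_opNorm_transpose _).symm.trans (congrArg norm h1)).trans_le
          (norm_sub_le _ _)).trans (add_le_add hK ?_)
        exact Matrix.l2_opNorm_mul_le_of_le hXR ((Matrix.l2_opNorm_transpose Y).trans_le h2)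
      have h4 := mul_le_mul_of_nonneg_right hβ1 (norm_nonneg (Y * Rᵀ - 1))
      linarith
    have h1 : V' * Rᵀ - V = V * (Y * Rᵀ - 1) + F * Rᵀ := by
      rw [hF, Matrix.sub_mul, Matrix.mul_sub, Matrix.mul_one]
      simp only [Matrix.mul_assoc]; abel
    have n1 := Matrix.l2_opNorm_mul_le_of_le hV hx
    have n2 := Matrix.l2_opNorm_mul_le_of_le hE2 hRtn
    rw [h1]
    refine (norm_add_le _ _).trans ?_
    have : 36 * δ / σ ^ 2 = 2 * (4 * δ / σ ^ 2 + β) + 2 * δ / σ ^ 2 := by rw [hβ]; ring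
    linarith

/-- The left inverses of two nearby factors are close. -/
theorem norm_pinv_sub_le (B : IsBalancedFactor H U V Ud Vd)
    (B' : IsBalancedFactor H' U' V' Ud' Vd') {a Δ : ℝ} (hUd : ‖Ud‖ ≤ a) (hUd' : ‖Ud'‖ ≤ a)
    (h : ‖U' - U‖ ≤ Δ) : ‖Ud' - Ud‖ ≤ 2 * a ^ 2 * Δ := by
  -- The second term accounts for the turning of the column space; it rests on `Ud' Ud'ᵀ U'ᵀ = Ud'`
  -- and `Uᵀ (1 - U Ud) = 0`. Each term is at most `a² Δ`.
  have h1 : Ud' - Ud = -(Ud' * (U' - U) * Ud) + Ud' * Ud'ᵀ * (U' - U)ᵀ * (1 - U * Ud) := by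
    have e1 : Uᵀ * (1 - U * Ud) = 0 := by
      have : Uᵀ * (U * Ud) = Uᵀ := by
        rw [← B.left_symm, ← Matrix.transpose_mul, Matrix.mul_assoc, B.left_inv, Matrix.mul_one]
      rw [Matrix.mul_sub, this, Matrix.mul_one, sub_self]
    rw [Matrix.transpose_sub, Matrix.mul_sub (Ud' * Ud'ᵀ), Matrix.sub_mul, B'.left_pinv_eq,
      Matrix.mul_assoc _ Uᵀ, e1, Matrix.mul_sub, Matrix.mul_sub, Matrix.sub_mul, B'.left_inv]
    simp only [Matrix.mul_assoc, Matrix.one_mul, Matrix.mul_one, Matrix.mul_zero]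
    abel
  rw [h1]
  refine (norm_add_le _ _).trans ?_
  rw [norm_neg]
  have n1 := Matrix.l2_opNorm_mul_le_of_le (Matrix.l2_opNorm_mul_le_of_le hUd' h) hUd
  have n2 := Matrix.l2_opNorm_mul_le_of_le (Matrix.l2_opNorm_mul_le_of_le
    (Matrix.l2_opNorm_mul_le_of_le hUd' ((Matrix.l2_opNorm_transpose _).trans_le hUd'))
    ((Matrix.l2_opNorm_transpose _).trans_le h)) B.norm_one_sub_le
  linarith

end IsBalancedFactor

/-! ### Stability of the realization -/

/-- The realization built from balanced factors depends continuously on the data, up to one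
rotation. -/
theorem IsBalancedFactor.exists_rotation_realization {ι κ τ : Type*} [Fintype ι] [DecidableEq ι]
    [Fintype κ] [DecidableEq κ] {H H' : Matrix ι ι ℝ} {U V U' V' : Matrix ι κ ℝ}
    {Ud Vd Ud' Vd' : Matrix κ ι ℝ} (B : IsBalancedFactor H U V Ud Vd)
    (B' : IsBalancedFactor H' U' V' Ud' Vd') (hH : H = U * Vᵀ) {δ σ a ε : ℝ}
    (hσ : 0 < σ) (hσ1 : σ ≤ 1) (hε1 : ε ≤ 1) (hδ1 : δ ≤ ε * σ ^ 4 / 600)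
    (ha2 : a ^ 2 = 2 / σ) (ha0 : 0 ≤ a)
    (hUd : ‖Ud‖ ≤ a) (hVd : ‖Vd‖ ≤ a) (hUd' : ‖Ud'‖ ≤ a) (hVd' : ‖Vd'‖ ≤ a)
    (hH1 : ‖H‖ ≤ 1) (hH1' : ‖H'‖ ≤ 1) (hδ : ‖H' - H‖ ≤ δ) (hres : ‖H' - U' * V'ᵀ‖ ≤ δ)
    (hD : ∀ x : κ → ℝ, σ * (x ⬝ᵥ x) ≤ x ⬝ᵥ ((Uᵀ * U) *ᵥ x))
    (K K' : τ → Matrix ι ι ℝ) (hK : ∀ j, ‖K j‖ ≤ 1) (hK' : ∀ j, ‖K' j‖ ≤ 1)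
    (hKδ : ∀ j, ‖K' j - K j‖ ≤ δ) (w : ι → ℝ)
    (hw1 : ‖WithLp.toLp 2 (H *ᵥ w)‖ ≤ 1) (hw2 : ‖WithLp.toLp 2 (Hᵀ *ᵥ w)‖ ≤ 1)
    (hw1δ : ‖WithLp.toLp 2 (H' *ᵥ w) - WithLp.toLp 2 (H *ᵥ w)‖ ≤ δ)
    (hw2δ : ‖WithLp.toLp 2 (H'ᵀ *ᵥ w) - WithLp.toLp 2 (Hᵀ *ᵥ w)‖ ≤ δ) :
    ∃ R ∈ Matrix.orthogonalGroup κ ℝ,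
      ‖WithLp.toLp 2 (Rᵀ *ᵥ (U'ᵀ *ᵥ w)) - WithLp.toLp 2 (Uᵀ *ᵥ w)‖ ≤ ε ∧
      ‖WithLp.toLp 2 (R⁻¹ *ᵥ (V'ᵀ *ᵥ w)) - WithLp.toLp 2 (Vᵀ *ᵥ w)‖ ≤ ε ∧
      ∀ j, ‖R⁻¹ * (Ud' * K' j * Vd'ᵀ) * R - Ud * K j * Vdᵀ‖ ≤ ε := by
  have hδ0 : 0 ≤ δ := (norm_nonneg _).trans hδ
  have hs4 : σ ^ 4 ≤ σ ^ 2 := pow_le_pow_of_le_one hσ.le hσ1 (by norm_num)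
  have hδ2 : δ ≤ σ ^ 2 / 100 := by
    have : ε * σ ^ 4 ≤ 1 * σ ^ 4 := by gcongr
    nlinarith [sq_nonneg σ]
  obtain ⟨R, hR, hUR, hVR⟩ := B.exists_rotation B' hH hσ hσ1 hδ2 ha2 ha0 hUd hVd hUd' hVd' hH1 hH1'
    hδ hres hD
  have hRR : R * Rᵀ = 1 := (Matrix.mem_orthogonalGroup_iff _ _).1 hR
  have hRtR : Rᵀ * R = 1 := mul_eq_one_comm.1 hRR
  have hRinv : R⁻¹ = Rᵀ := Matrix.inv_eq_left_inv hRtR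
  have hRt : ‖Rᵀ‖ ≤ 1 := (Matrix.l2_opNorm_transpose R).trans_le
    (Matrix.l2_opNorm_le_one_of_transpose_mul_self hRtR)
  have Br := B'.rotate hRR
  have hX' : ‖Rᵀ * Ud'‖ ≤ a := by simpa using Matrix.l2_opNorm_mul_le_of_le hRt hUd'
  have hY' : ‖Rᵀ * Vd'‖ ≤ a := by simpa using Matrix.l2_opNorm_mul_le_of_le hRt hVd'
  have hX := B.norm_pinv_sub_le Br hUd hX' hUR
  have hY := B.swap.norm_pinv_sub_le Br.swap hVd hY' hVR
  -- Only `H w` and `Hᵀ w` are bounded, not `w`, so all four vectors are rewritten through the data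
  -- matrices.
  have e1 : Rᵀ *ᵥ (U'ᵀ *ᵥ w) = (Rᵀ * Vd') *ᵥ (H'ᵀ *ᵥ w) := by
    rw [Matrix.mulVec_mulVec, Matrix.mulVec_mulVec, Matrix.mul_assoc, B'.left_eq]
  have e2 : Rᵀ *ᵥ (V'ᵀ *ᵥ w) = (Rᵀ * Ud') *ᵥ (H' *ᵥ w) := by
    rw [Matrix.mulVec_mulVec, Matrix.mulVec_mulVec, Matrix.mul_assoc, B'.right_eq]
  have e3 : Uᵀ *ᵥ w = Vd *ᵥ (Hᵀ *ᵥ w) := by rw [Matrix.mulVec_mulVec, B.left_eq]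
  have e4 : Vᵀ *ᵥ w = Ud *ᵥ (H *ᵥ w) := by rw [Matrix.mulVec_mulVec, B.right_eq]
  have e5 : ∀ j, Rᵀ * (Ud' * K' j * Vd'ᵀ) * R = (Rᵀ * Ud') * K' j * (Rᵀ * Vd')ᵀ := fun j => by
    simp only [Matrix.transpose_mul, Matrix.transpose_transpose, Matrix.mul_assoc]
  set X' := Rᵀ * Ud'
  set Y' := Rᵀ * Vd'
  have hp : 2 * a ^ 2 * (36 * δ / σ ^ 2) = 144 * δ / σ ^ 3 := by rw [ha2]; field_simp; ring
  rw [hp] at hX hY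
  set p := 144 * δ / σ ^ 3 with hpdef
  have hp0 : 0 ≤ p := by positivity
  have ha : a ≤ 2 / σ := by
    refine le_of_sq_le_sq ?_ (by positivity)
    rw [ha2, div_pow, div_le_div_iff₀ hσ (by positivity)]
    nlinarith
  have ha1 : 1 ≤ 2 / σ := by rw [le_div_iff₀ hσ]; linarith
  -- The largest total below is `2 · 288 + 4 = 580`, for the matrices, hence the 600 of the
  -- hypothesis. The power `σ⁴` covers `a p`, which is of order `δ σ^{-7/2}`.
  have hfinal : 300 * δ / σ ^ 4 + 300 * δ / σ ^ 4 ≤ ε := by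
    rw [← add_div, div_le_iff₀ (by positivity)]; linarith
  have hpa : a * p ≤ 288 * δ / σ ^ 4 := by
    calc a * p ≤ 2 / σ * p := by gcongr
      _ = _ := by rw [hpdef]; field_simp; ring
  have hp1 : p ≤ 288 * δ / σ ^ 4 := by
    calc p ≤ 2 / σ * p := le_mul_of_one_le_left hp0 ha1
      _ = _ := by rw [hpdef]; field_simp; ring
  have haδ : a * δ ≤ 2 * δ / σ ^ 4 := by
    calc a * δ ≤ 2 / σ * δ := by gcongr
      _ = 2 * δ / σ := by ring
      _ ≤ _ := by gcongr; exact pow_le_of_le_one hσ.le hσ1 (by norm_num)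
  have haδ2 : a * δ * a ≤ 4 * δ / σ ^ 4 := by
    calc a * δ * a = 2 * δ / σ := by rw [show a * δ * a = a ^ 2 * δ by ring, ha2]; ring
      _ ≤ 4 * δ / σ ^ 4 := by
        gcongr
        · norm_num
        · exact pow_le_of_le_one hσ.le hσ1 (by norm_num)
  have hq : 0 ≤ δ / σ ^ 4 := by positivity
  have vec : ∀ (Z Z' : Matrix κ ι ℝ) (x x' : ι → ℝ), ‖Z'‖ ≤ a → ‖Z' - Z‖ ≤ p →
      ‖WithLp.toLp 2 x‖ ≤ 1 → ‖WithLp.toLp 2 x' - WithLp.toLp 2 x‖ ≤ δ →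
      ‖WithLp.toLp 2 (Z' *ᵥ x') - WithLp.toLp 2 (Z *ᵥ x)‖ ≤ ε := by
    intro Z Z' x x' h1 h2 h3 h4
    have h5 : WithLp.toLp 2 (Z' *ᵥ x') - WithLp.toLp 2 (Z *ᵥ x)
        = (WithLp.toLp 2 (Z' *ᵥ (x' - x)) + WithLp.toLp 2 ((Z' - Z) *ᵥ x) :
          EuclideanSpace ℝ κ) := by
      rw [← WithLp.toLp_sub, ← WithLp.toLp_add, Matrix.mulVec_sub, Matrix.sub_mulVec]
      congr 1; abel
    rw [h5]
    rw [← WithLp.toLp_sub] at h4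
    have n1 := (Matrix.norm_toLp_mulVec_le Z' (x' - x)).trans
      (mul_le_mul h1 h4 (norm_nonneg _) ha0)
    have n2 := (Matrix.norm_toLp_mulVec_le (Z' - Z) x).trans
      (mul_le_mul h2 h3 (norm_nonneg _) hp0)
    refine (norm_add_le _ _).trans ((add_le_add n1 n2).trans (le_trans ?_ hfinal))
    calc a * δ + p * 1 ≤ 2 * δ / σ ^ 4 + 288 * δ / σ ^ 4 := by linarith
      _ = 290 * (δ / σ ^ 4) := by ring
      _ ≤ 600 * (δ / σ ^ 4) := by linarith
      _ = _ := by ring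
  refine ⟨R, hR, ?_, ?_, fun j => ?_⟩
  · rw [e1, e3]; exact vec _ _ _ _ hY' hY hw2 hw2δ
  · rw [hRinv, e2, e4]; exact vec _ _ _ _ hX' hX hw1 hw1δ
  · rw [hRinv, e5]
    have h1 : X' * K' j * Y'ᵀ - Ud * K j * Vdᵀ
        = (X' - Ud) * K' j * Y'ᵀ + Ud * (K' j - K j) * Y'ᵀ + Ud * K j * (Y' - Vd)ᵀ := by
      rw [Matrix.transpose_sub]
      simp only [Matrix.sub_mul, Matrix.mul_sub]
      abel
    have n1 := Matrix.l2_opNorm_mul_le_of_le (Matrix.l2_opNorm_mul_le_of_le hX (hK' j))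
      ((Matrix.l2_opNorm_transpose Y').trans_le hY')
    have n2 := Matrix.l2_opNorm_mul_le_of_le (Matrix.l2_opNorm_mul_le_of_le hUd (hKδ j))
      ((Matrix.l2_opNorm_transpose Y').trans_le hY')
    have n3 := Matrix.l2_opNorm_mul_le_of_le (Matrix.l2_opNorm_mul_le_of_le hUd (hK j))
      ((Matrix.l2_opNorm_transpose (Y' - Vd)).trans_le hY)
    rw [h1]
    refine norm_add₃_le.trans ((add_le_add (add_le_add n1 n2) n3).trans (le_trans ?_ hfinal))
    calc p * 1 * a + a * δ * a + a * 1 * p = 2 * (a * p) + a * δ * a := by ring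
      _ ≤ 2 * (288 * δ / σ ^ 4) + 4 * δ / σ ^ 4 := by linarith
      _ = 580 * (δ / σ ^ 4) := by ring
      _ ≤ 600 * (δ / σ ^ 4) := by linarith
      _ = _ := by ring

/-! ### Weyl's inequality and uniqueness of singular values -/

section SingularValues

variable {E F : Type*} [NormedAddCommGroup E] [InnerProductSpace ℝ E] [NormedAddCommGroup F]
  [InnerProductSpace ℝ F] {N : ℕ}

/-- Dimension count: the span of the first `i + 1` coordinate directions meets the kernel of `i`
linear conditions, and on that span `T` stretches by at least `s i`. The conditions will be leading
coordinates of a second decomposition (Weyl) or a rank factorization. -/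
theorem exists_ne_zero_mul_norm_le (c : E ≃ₗᵢ[ℝ] EuclideanSpace ℝ (Fin N)) {s : Fin N → ℝ}
    (hs : Antitone s) (h0 : ∀ i, 0 ≤ s i) (T : E →ₗ[ℝ] F)
    (hT : ∀ x, ‖T x‖ ^ 2 = ∑ i, (s i * c x i) ^ 2) (i : Fin N) (φ : E →ₗ[ℝ] (Fin i → ℝ)) :
    ∃ x ≠ 0, φ x = 0 ∧ s i * ‖x‖ ≤ ‖T x‖ := by
  let f : (Fin (i + 1) → ℝ) → Fin N → ℝ :=
    fun y j => if h : (j : ℕ) < i + 1 then y ⟨j, h⟩ else 0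
  let inc : (Fin (i + 1) → ℝ) →ₗ[ℝ] EuclideanSpace ℝ (Fin N) :=
    { toFun := fun y => WithLp.toLp 2 (f y)
      map_add' := fun y z => by
        ext j
        change f (y + z) j = f y j + f z j
        simp only [f]
        split_ifs <;> simp
      map_smul' := fun a y => by
        ext j
        change f (a • y) j = a * f y j
        simp only [f]
        split_ifs <;> simp }
  have hinc : ∀ y j, inc y j = if h : (j : ℕ) < i + 1 then y ⟨j, h⟩ else 0 := fun y j => rfl
  obtain ⟨y, hy, hy0⟩ := (Submodule.ne_bot_iff _).1
    ((φ ∘ₗ c.symm.toLinearEquiv.toLinearMap ∘ₗ inc).ker_ne_bot_of_finrank_lt (by simp))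
  refine ⟨c.symm (inc y), ?_, hy, ?_⟩
  · intro h
    apply hy0
    have h1 : inc y = 0 := by simpa using h
    ext l
    have h2 := hinc y ⟨l, by omega⟩
    rw [h1, dif_pos l.2] at h2
    exact h2.symm
  · refine le_of_sq_le_sq ?_ (norm_nonneg _)
    rw [hT, mul_pow, c.symm.norm_map, EuclideanSpace.norm_sq_eq, Finset.mul_sum]
    refine Finset.sum_le_sum fun j _ => ?_
    rw [c.apply_symm_apply, mul_pow, Real.norm_eq_abs, sq_abs]
    by_cases h : (j : ℕ) < i + 1
    · have : s i ≤ s j := hs (Fin.le_def.2 (by omega))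
      have := h0 i
      gcongr
    · rw [hinc, dif_neg h]; simp

theorem norm_le_mul_of_coord_eq_zero (c : E ≃ₗᵢ[ℝ] EuclideanSpace ℝ (Fin N)) {s : Fin N → ℝ}
    (hs : Antitone s) (h0 : ∀ i, 0 ≤ s i) (T : E →ₗ[ℝ] F)
    (hT : ∀ x, ‖T x‖ ^ 2 = ∑ i, (s i * c x i) ^ 2) (i : Fin N) (x : E)
    (hx : ∀ j < i, c x j = 0) : ‖T x‖ ≤ s i * ‖x‖ := by
  refine le_of_sq_le_sq ?_ (mul_nonneg (h0 i) (norm_nonneg _))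
  rw [hT, mul_pow, ← c.norm_map, EuclideanSpace.norm_sq_eq, Finset.mul_sum]
  refine Finset.sum_le_sum fun j _ => ?_
  rw [mul_pow, Real.norm_eq_abs, sq_abs]
  by_cases h : j < i
  · rw [hx j h]; simp
  · have := hs (not_lt.1 h)
    have := h0 j
    gcongr

/-- Weyl's inequality for singular values. -/
theorem singular_value_le_add (c c' : E ≃ₗᵢ[ℝ] EuclideanSpace ℝ (Fin N)) {s t : Fin N → ℝ}
    (hs : Antitone s) (hs0 : ∀ i, 0 ≤ s i) (ht : Antitone t) (ht0 : ∀ i, 0 ≤ t i)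
    (T T' : E →ₗ[ℝ] F) (hT : ∀ x, ‖T x‖ ^ 2 = ∑ i, (s i * c x i) ^ 2)
    (hT' : ∀ x, ‖T' x‖ ^ 2 = ∑ i, (t i * c' x i) ^ 2) {δ : ℝ}
    (hδ : ∀ x, ‖T x - T' x‖ ≤ δ * ‖x‖) (i : Fin N) : s i ≤ t i + δ := by
  let φ : E →ₗ[ℝ] (Fin i → ℝ) :=
    { toFun := fun x j => c' x ⟨j, by omega⟩
      map_add' := fun x y => by ext j; simp
      map_smul' := fun a x => by ext j; simp }
  obtain ⟨x, hx0, hφ, hx⟩ := exists_ne_zero_mul_norm_le c hs hs0 T hT i φ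
  have h1 := norm_le_mul_of_coord_eq_zero c' ht ht0 T' hT' i x fun j hj => congrFun hφ ⟨j, hj⟩
  have h2 : ‖T x‖ ≤ ‖T' x‖ + ‖T x - T' x‖ := by
    calc ‖T x‖ = ‖T' x + (T x - T' x)‖ := by congr 1; abel
      _ ≤ _ := norm_add_le _ _
  have h3 : s i * ‖x‖ ≤ (t i + δ) * ‖x‖ := by linarith [hδ x]
  exact le_of_mul_le_mul_right h3 (norm_pos_iff.2 hx0)

/-- Brings `LinearMap.singularValues` into the coordinate form of Weyl's inequality, by an
eigenbasis of `T* T`. -/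
theorem norm_sq_eq_sum_singularValues [FiniteDimensional ℝ E] [FiniteDimensional ℝ F]
    (hN : Module.finrank ℝ E = N) (T : E →ₗ[ℝ] F) (x : E) :
    ‖T x‖ ^ 2 = ∑ i : Fin N, (T.singularValues i *
      (T.isSymmetric_adjoint_comp_self.eigenvectorBasis hN).repr x i) ^ 2 := by
  set b := T.isSymmetric_adjoint_comp_self.eigenvectorBasis hN
  have h1 : ‖T x‖ ^ 2 = inner ℝ (b.repr x) (b.repr ((T.adjoint ∘ₗ T) x)) := by
    rw [LinearIsometryEquiv.inner_map_map, LinearMap.comp_apply, LinearMap.adjoint_inner_right,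
      real_inner_self_eq_norm_sq]
  rw [h1, PiLp.inner_apply]
  refine Finset.sum_congr rfl fun i _ => ?_
  rw [LinearMap.IsSymmetric.eigenvectorBasis_apply_self_apply, mul_pow, T.sq_singularValues_fin hN]
  simp; ring

end SingularValues

namespace IsSVD

variable {ι : Type*} [Fintype ι] [DecidableEq ι] {N r : ℕ} {H H' : Matrix ι ι ℝ}
  {P R P' R' : Matrix ι (Fin N) ℝ} {s s' : Fin N → ℝ}

/-- The isometry to the coordinates given by the right singular vectors. -/
noncomputable def coord (h : IsSVD H P s R) : EuclideanSpace ℝ ι ≃ₗᵢ[ℝ] EuclideanSpace ℝ (Fin N) where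
  toFun x := WithLp.toLp 2 (Rᵀ *ᵥ x.ofLp)
  invFun y := WithLp.toLp 2 (R *ᵥ y.ofLp)
  map_add' x y := by simp [Matrix.mulVec_add]
  map_smul' a x := by simp [Matrix.mulVec_smul]
  left_inv x := by simp [Matrix.mulVec_mulVec, h.right_orth']
  right_inv y := by simp [Matrix.mulVec_mulVec, h.right_orth]
  norm_map' x := by
    refine (sq_eq_sq₀ (norm_nonneg _) (norm_nonneg _)).1 ?_
    change ‖WithLp.toLp 2 (Rᵀ *ᵥ x.ofLp)‖ ^ 2 = ‖WithLp.toLp 2 x.ofLp‖ ^ 2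
    rw [norm_toLp_sq_eq_dotProduct, norm_toLp_sq_eq_dotProduct, Matrix.dotProduct_mulVec,
      Matrix.vecMul_transpose, Matrix.mulVec_mulVec, h.right_orth', Matrix.one_mulVec]

theorem norm_sq_mulVec (h : IsSVD H P s R) (x : EuclideanSpace ℝ ι) :
    ‖Matrix.toEuclideanLin H x‖ ^ 2 = ∑ i, (s i * h.coord x i) ^ 2 := by
  have h1 : Matrix.toEuclideanLin H x
      = WithLp.toLp 2 (P *ᵥ (Matrix.diagonal s *ᵥ (Rᵀ *ᵥ x.ofLp))) := by
    rw [Matrix.mulVec_mulVec, Matrix.mulVec_mulVec, ← h.eq]; rfl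
  rw [h1, norm_toLp_sq_eq_dotProduct, Matrix.dotProduct_mulVec, ← Matrix.mulVec_transpose,
    Matrix.mulVec_mulVec, h.left_orth, Matrix.one_mulVec, ← norm_toLp_sq_eq_dotProduct,
    norm_toLp_sq]
  simp [Matrix.mulVec_diagonal, coord]

theorem le_add_of_norm_sub_le (h : IsSVD H P s R) (h' : IsSVD H' P' s' R') {δ : ℝ}
    (hδ : ‖H - H'‖ ≤ δ) (i : Fin N) : s i ≤ s' i + δ := by
  refine singular_value_le_add h.coord h'.coord h.antitone h.nonneg h'.antitone h'.nonneg _ _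
    h.norm_sq_mulVec h'.norm_sq_mulVec (fun x => ?_) i
  have h1 := (Matrix.norm_toLp_mulVec_le (H - H') x.ofLp).trans
    (mul_le_mul_of_nonneg_right hδ (norm_nonneg _))
  rw [Matrix.sub_mulVec] at h1
  exact h1

/-- Weyl's inequality with `δ = 0`, in both directions. This ties `sigma` to whichever decomposition
the algorithm picks. -/
theorem eq_singularValues (h : IsSVD H P s R) (i : Fin N) :
    s i = (Matrix.toEuclideanLin H).singularValues i := by
  have hN : Module.finrank ℝ (EuclideanSpace ℝ ι) = N := by
    rw [h.coord.toLinearEquiv.finrank_eq]; simp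
  have ht : Antitone fun j : Fin N => (Matrix.toEuclideanLin H).singularValues j :=
    fun j l hjl => LinearMap.singularValues_antitone _ hjl
  have ht0 : ∀ j : Fin N, 0 ≤ (Matrix.toEuclideanLin H).singularValues j :=
    fun j => LinearMap.singularValues_nonneg _ _
  have hT := norm_sq_eq_sum_singularValues hN (Matrix.toEuclideanLin H)
  refine le_antisymm ?_ ?_
  · have := singular_value_le_add h.coord _ h.antitone h.nonneg ht ht0 _ _ h.norm_sq_mulVec hT
      (δ := 0) (by simp) i
    simpa using this
  · have := singular_value_le_add _ h.coord ht ht0 h.antitone h.nonneg _ _ hT h.norm_sq_mulVec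
      (δ := 0) (by simp) i
    simpa using this

/-- The conditions `C x = 0`, padded with zeros to `i ≥ r` of them, leave a nonzero `x` with `s i
‖x‖ ≤ ‖H x‖ = 0`. -/
theorem eq_zero_of_factorization (h : IsSVD H P s R) (A : Matrix ι (Fin r) ℝ)
    (C : Matrix (Fin r) ι ℝ) (hAC : H = A * C) (i : Fin N) (hi : r ≤ i) : s i = 0 := by
  let φ : EuclideanSpace ℝ ι →ₗ[ℝ] (Fin i → ℝ) :=
    { toFun := fun x j => if hj : (j : ℕ) < r then (C *ᵥ x.ofLp) ⟨j, hj⟩ else 0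
      map_add' := fun x y => by
        ext j; by_cases hj : (j : ℕ) < r <;> simp [hj, Matrix.mulVec_add]
      map_smul' := fun a x => by
        ext j; by_cases hj : (j : ℕ) < r <;> simp [hj, Matrix.mulVec_smul] }
  obtain ⟨x, hx0, hφ, hx⟩ := exists_ne_zero_mul_norm_le h.coord h.antitone h.nonneg _
    h.norm_sq_mulVec i φ
  have hC : C *ᵥ x.ofLp = 0 := by
    ext j
    have := congrFun hφ ⟨j, by omega⟩
    simpa [φ] using this
  have hHx : Matrix.toEuclideanLin H x = 0 := by
    change WithLp.toLp 2 (H *ᵥ x.ofLp) = 0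
    rw [hAC, ← Matrix.mulVec_mulVec, hC, Matrix.mulVec_zero]; rfl
  rw [hHx, norm_zero] at hx
  have h1 := norm_pos_iff.2 hx0
  have h2 := h.nonneg i
  nlinarith

end IsSVD

/-! ### Truncated decompositions yield balanced factors -/

/-- The inclusion of the first `r` coordinates. -/
def leadingCoords {N r : ℕ} (hr : r ≤ N) : Matrix (Fin N) (Fin r) ℝ :=
  Matrix.of fun j i => if j = Fin.castLE hr i then 1 else 0

section Leading

variable {ι : Type*} [Fintype ι] [DecidableEq ι] {N r : ℕ} (hr : r ≤ N)

theorem mul_leadingCoords_apply (A : Matrix ι (Fin N) ℝ) (a : ι) (i : Fin r) :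
    (A * leadingCoords hr) a i = A a (Fin.castLE hr i) := by
  simp [Matrix.mul_apply, leadingCoords]

theorem scaledFactor_eq (P : Matrix ι (Fin N) ℝ) (s : Fin N → ℝ) :
    scaledFactor hr P s = P * leadingCoords hr *
      Matrix.diagonal fun i : Fin r => √(s (Fin.castLE hr i)) := by
  ext a i
  rw [Matrix.mul_diagonal, mul_leadingCoords_apply]; rfl

theorem leadingCoords_transpose_mul_self : (leadingCoords hr)ᵀ * leadingCoords hr = 1 := by
  ext i j
  rw [mul_leadingCoords_apply, Matrix.transpose_apply, Matrix.one_apply]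
  simp [leadingCoords, eq_comm]

theorem diagonal_mul_leadingCoords (s : Fin N → ℝ) :
    Matrix.diagonal s * leadingCoords hr
      = leadingCoords hr * Matrix.diagonal fun i : Fin r => s (Fin.castLE hr i) := by
  ext j i
  rw [Matrix.diagonal_mul, Matrix.mul_diagonal]
  simp only [leadingCoords, Matrix.of_apply]
  split_ifs with h
  · rw [h]; ring
  · simp

theorem leadingCoords_mul_transpose : leadingCoords hr * (leadingCoords hr)ᵀ
    = Matrix.diagonal fun j : Fin N => if (j : ℕ) < r then (1 : ℝ) else 0 := by
  ext j l
  rw [Matrix.mul_apply, Matrix.diagonal_apply]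
  simp only [leadingCoords, Matrix.of_apply, Matrix.transpose_apply, mul_ite, mul_one, mul_zero]
  by_cases hl : (l : ℕ) < r
  · have : ∀ i : Fin r, l = Fin.castLE hr i ↔ i = ⟨l, hl⟩ := fun i => by
      simp only [Fin.ext_iff, Fin.val_castLE]; exact eq_comm
    simp only [this, Finset.sum_ite_eq', Finset.mem_univ, if_true]
    by_cases hjl : j = l
    · subst hjl; simp [hl]
    · rw [if_neg hjl, if_neg]; exact fun h => hjl (h.trans (Fin.ext rfl))
  · have : ∀ i : Fin r, l ≠ Fin.castLE hr i := fun i h => hl (by rw [h]; exact i.2)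
    simp only [this, if_false, Finset.sum_const_zero]
    by_cases hjl : j = l
    · subst hjl; simp [hl]
    · rw [if_neg hjl]

theorem scaledFactor_gram {P : Matrix ι (Fin N) ℝ} (hP : Pᵀ * P = 1) {s : Fin N → ℝ}
    (h0 : ∀ i, 0 ≤ s i) : (scaledFactor hr P s)ᵀ * scaledFactor hr P s
      = Matrix.diagonal fun i : Fin r => s (Fin.castLE hr i) := by
  set S := Matrix.diagonal fun i : Fin r => √(s (Fin.castLE hr i)) with hS
  have hSt : Sᵀ = S := Matrix.diagonal_transpose _
  have hSS : S * S = Matrix.diagonal fun i : Fin r => s (Fin.castLE hr i) := by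
    rw [hS, Matrix.diagonal_mul_diagonal]
    congr 1; ext i; exact Real.mul_self_sqrt (h0 _)
  rw [scaledFactor_eq, ← hS, ← hSS]
  calc (P * leadingCoords hr * S)ᵀ * (P * leadingCoords hr * S)
      = S * ((leadingCoords hr)ᵀ * (Pᵀ * P) * leadingCoords hr) * S := by
        simp only [Matrix.transpose_mul, hSt, Matrix.mul_assoc]
    _ = S * S := by
        rw [hP, Matrix.mul_one, leadingCoords_transpose_mul_self, Matrix.mul_one]

theorem scaledFactor_mul_transpose {P R : Matrix ι (Fin N) ℝ} {s : Fin N → ℝ}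
    (h0 : ∀ i, 0 ≤ s i) : scaledFactor hr P s * (scaledFactor hr R s)ᵀ
      = P * (Matrix.diagonal fun j : Fin N => if (j : ℕ) < r then s j else 0) * Rᵀ := by
  set S := Matrix.diagonal fun i : Fin r => √(s (Fin.castLE hr i)) with hS
  have hSt : Sᵀ = S := Matrix.diagonal_transpose _
  have hSS : S * S = Matrix.diagonal fun i : Fin r => s (Fin.castLE hr i) := by
    rw [hS, Matrix.diagonal_mul_diagonal]
    congr 1; ext i; exact Real.mul_self_sqrt (h0 _)
  rw [scaledFactor_eq, scaledFactor_eq, ← hS]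
  calc P * leadingCoords hr * S * (R * leadingCoords hr * S)ᵀ
      = P * ((leadingCoords hr * (S * S)) * (leadingCoords hr)ᵀ) * Rᵀ := by
        simp only [Matrix.transpose_mul, hSt, Matrix.mul_assoc]
    _ = _ := by
        rw [hSS, ← diagonal_mul_leadingCoords, Matrix.mul_assoc (Matrix.diagonal s), leadingCoords_mul_transpose,
          Matrix.diagonal_mul_diagonal]
        simp

end Leading

namespace IsPseudoInverse

variable {ι κ : Type*} [Fintype ι] [DecidableEq ι] [Fintype κ] [DecidableEq κ]
  {U : Matrix ι κ ℝ} {Ud : Matrix κ ι ℝ}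

theorem gram_mul (h : IsPseudoInverse U Ud) : Uᵀ * U * Ud = Uᵀ := by
  rw [Matrix.mul_assoc, ← h.ab_symm, ← Matrix.transpose_mul, h.aba]

theorem left_inv (h : IsPseudoInverse U Ud) {t : κ → ℝ} (ht : ∀ i, t i ≠ 0)
    (hU : Uᵀ * U = Matrix.diagonal t) : Ud * U = 1 := by
  have hti : (Matrix.diagonal fun i => (t i)⁻¹) * Matrix.diagonal t = 1 := by
    rw [Matrix.diagonal_mul_diagonal, ← Matrix.diagonal_one]
    congr 1; ext i; exact inv_mul_cancel₀ (ht i)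
  have h1 : Matrix.diagonal t * (Ud * U) = Matrix.diagonal t := by
    rw [← Matrix.mul_assoc, ← hU, h.gram_mul]
  have h2 := congrArg (fun A => (Matrix.diagonal fun i => (t i)⁻¹) * A) h1
  simpa only [← Matrix.mul_assoc, hti, Matrix.one_mul] using h2

/-- `Ud Udᵀ` is the inverse of the Gram matrix `diag t`, so `‖Ud‖² ≤ 1/m`. -/
theorem norm_le (h : IsPseudoInverse U Ud) {t : κ → ℝ} {m a : ℝ} (hm : 0 < m)
    (ht : ∀ i, m ≤ t i) (hU : Uᵀ * U = Matrix.diagonal t) (ha0 : 0 ≤ a) (ha : m⁻¹ ≤ a ^ 2) :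
    ‖Ud‖ ≤ a := by
  have ht0 : ∀ i, t i ≠ 0 := fun i => (hm.trans_le (ht i)).ne'
  have htt : Matrix.diagonal t * (Matrix.diagonal fun i => (t i)⁻¹) = 1 := by
    rw [Matrix.diagonal_mul_diagonal, ← Matrix.diagonal_one]
    congr 1; ext i; exact mul_inv_cancel₀ (ht0 i)
  have h1 : Ud * Udᵀ * Matrix.diagonal t = 1 := by
    rw [← hU, ← Matrix.mul_assoc, Matrix.mul_assoc Ud, ← Matrix.transpose_mul, h.ab_symm,
      ← Matrix.mul_assoc, h.left_inv ht0 hU, Matrix.one_mul, h.left_inv ht0 hU]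
  have h2 : Ud * Udᵀ = Matrix.diagonal fun i => (t i)⁻¹ := by
    rw [← Matrix.mul_one (Ud * Udᵀ), ← htt, ← Matrix.mul_assoc, h1, Matrix.one_mul]
  have h3 : ‖Ud * Udᵀ‖ ≤ a ^ 2 := by
    rw [h2, Matrix.l2_opNorm_diagonal]
    refine (pi_norm_le_iff_of_nonneg (sq_nonneg a)).2 fun i => ?_
    rw [Real.norm_eq_abs, abs_of_pos (inv_pos.2 (hm.trans_le (ht i)))]
    exact (inv_anti₀ hm (ht i)).trans ha
  rw [Matrix.l2_opNorm_mul_transpose_self, ← sq] at h3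
  exact le_of_sq_le_sq h3 ha0

end IsPseudoInverse

namespace IsSVD

variable {ι : Type*} [Fintype ι] [DecidableEq ι] {N r : ℕ} {H H' : Matrix ι ι ℝ}
  {P R P' R' : Matrix ι (Fin N) ℝ} {s s' : Fin N → ℝ}

theorem mul_right_scaledFactor (h : IsSVD H P s R) (hr : r ≤ N) :
    H * scaledFactor hr R s
      = scaledFactor hr P s * Matrix.diagonal fun i : Fin r => s (Fin.castLE hr i) := by
  rw [scaledFactor_eq, scaledFactor_eq]
  conv_lhs => rw [h.eq]
  calc P * Matrix.diagonal s * Rᵀ * (R * leadingCoords hr *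
        Matrix.diagonal fun i : Fin r => √(s (Fin.castLE hr i)))
      = P * (Matrix.diagonal s * (Rᵀ * R) * leadingCoords hr) *
        Matrix.diagonal fun i : Fin r => √(s (Fin.castLE hr i)) := by
        simp only [Matrix.mul_assoc]
    _ = _ := by
        rw [h.right_orth, Matrix.mul_one, diagonal_mul_leadingCoords]
        simp only [Matrix.mul_assoc, Matrix.diagonal_mul_diagonal, mul_comm]

theorem transpose (h : IsSVD H P s R) : IsSVD Hᵀ R s P where
  left_orth := h.right_orth
  left_orth' := h.right_orth'
  right_orth := h.left_orth
  right_orth' := h.left_orth'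
  nonneg := h.nonneg
  antitone := h.antitone
  eq := by
    conv_lhs => rw [h.eq]
    simp [Matrix.mul_assoc]

/-- Both sides become `Uᵀ H` after multiplication by the invertible Gram matrix. No rank condition
on `H` is involved, so the empirical matrix is covered. -/
theorem pinv_mul (h : IsSVD H P s R) (hr : r ≤ N) (hs : ∀ i : Fin r, s (Fin.castLE hr i) ≠ 0)
    {Ud : Matrix (Fin r) ι ℝ} (hU : IsPseudoInverse (scaledFactor hr P s) Ud) :
    Ud * H = (scaledFactor hr R s)ᵀ := by
  have h1 := congrArg Matrix.transpose (h.transpose.mul_right_scaledFactor hr)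
  rw [Matrix.transpose_mul, Matrix.transpose_mul, Matrix.transpose_transpose,
    Matrix.diagonal_transpose] at h1
  have h2 := hU.gram_mul
  rw [scaledFactor_gram hr h.left_orth h.nonneg] at h2
  have hti : (Matrix.diagonal fun i : Fin r => (s (Fin.castLE hr i))⁻¹) *
      (Matrix.diagonal fun i : Fin r => s (Fin.castLE hr i)) = 1 := by
    rw [Matrix.diagonal_mul_diagonal, ← Matrix.diagonal_one]
    congr 1; ext i; exact inv_mul_cancel₀ (hs i)
  have h3 := congrArg (fun A => (Matrix.diagonal fun i : Fin r => (s (Fin.castLE hr i))⁻¹) * A)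
    (((congrArg (· * H) h2).trans h1))
  simpa only [Matrix.mul_assoc, ← Matrix.mul_assoc (Matrix.diagonal fun i : Fin r =>
    (s (Fin.castLE hr i))⁻¹), hti, Matrix.one_mul] using h3

theorem isBalancedFactor (h : IsSVD H P s R) (hr : r ≤ N)
    (hs : ∀ i : Fin r, s (Fin.castLE hr i) ≠ 0) {Ud Vd : Matrix (Fin r) ι ℝ}
    (hU : IsPseudoInverse (scaledFactor hr P s) Ud)
    (hV : IsPseudoInverse (scaledFactor hr R s) Vd) :
    IsBalancedFactor H (scaledFactor hr P s) (scaledFactor hr R s) Ud Vd where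
  left_inv := hU.left_inv hs (scaledFactor_gram hr h.left_orth h.nonneg)
  left_symm := hU.ab_symm
  right_inv := hV.left_inv hs (scaledFactor_gram hr h.right_orth h.nonneg)
  right_symm := hV.ab_symm
  left_eq := h.transpose.pinv_mul hr hs hV
  right_eq := h.pinv_mul hr hs hU
  gram := by
    rw [scaledFactor_gram hr h.left_orth h.nonneg, scaledFactor_gram hr h.right_orth h.nonneg]

/-- Needed with `c = 0` for the exact matrix and with `c = δ` for the empirical one. -/
theorem norm_sub_truncation_le (h : IsSVD H P s R) (hr : r ≤ N) {c : ℝ} (hc : 0 ≤ c)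
    (hs : ∀ j : Fin N, r ≤ j → s j ≤ c) :
    ‖H - scaledFactor hr P s * (scaledFactor hr R s)ᵀ‖ ≤ c := by
  rw [scaledFactor_mul_transpose hr h.nonneg]
  conv_lhs => rw [h.eq]
  rw [← Matrix.sub_mul, ← Matrix.mul_sub, Matrix.diagonal_sub]
  have hd : ‖Matrix.diagonal fun j : Fin N => s j - if (j : ℕ) < r then s j else 0‖ ≤ c := by
    rw [Matrix.l2_opNorm_diagonal]
    refine (pi_norm_le_iff_of_nonneg hc).2 fun j => ?_
    rw [Real.norm_eq_abs]
    split_ifs with hj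
    · simpa using hc
    · rw [sub_zero, abs_of_nonneg (h.nonneg j)]; exact hs j (not_lt.1 hj)
  have := Matrix.l2_opNorm_mul_le_of_le (Matrix.l2_opNorm_mul_le_of_le
    (Matrix.l2_opNorm_le_one_of_transpose_mul_self h.left_orth) hd)
    ((Matrix.l2_opNorm_transpose R).trans_le
      (Matrix.l2_opNorm_le_one_of_transpose_mul_self h.right_orth))
  linarith

end IsSVD

/-! ### Deterministic stability of the algorithm -/

/-- Outputs of the spectral realization algorithm on nearby inputs, of which the exact one has
rank at most `k`, are close up to a rotation. -/
theorem exists_changeBasis_close {d n k : ℕ} (hk : 1 ≤ k) {σ δ ε : ℝ}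
    {H H' : Matrix (Word d n) (Word d n) ℝ} {K K' : Fin d → Matrix (Word d n) (Word d n) ℝ}
    (hσdef : σ = sigma H k) (hσ : 0 < σ) (hε1 : ε ≤ 1) (hδ1 : δ ≤ ε * σ ^ 4 / 600)
    (A : Matrix (Word d n) (Fin k) ℝ) (C : Matrix (Fin k) (Word d n) ℝ) (hAC : H = A * C)
    (hH1 : ‖H‖ ≤ 1) (hH1' : ‖H'‖ ≤ 1) (hδ : ‖H' - H‖ ≤ δ)
    (hK : ∀ j, ‖K j‖ ≤ 1) (hK' : ∀ j, ‖K' j‖ ≤ 1) (hKδ : ∀ j, ‖K' j - K j‖ ≤ δ)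
    (hw1 : ‖WithLp.toLp 2 (H *ᵥ fun _ => 1)‖ ≤ 1) (hw2 : ‖WithLp.toLp 2 (Hᵀ *ᵥ fun _ => 1)‖ ≤ 1)
    (hw1δ : ‖WithLp.toLp 2 (H' *ᵥ fun _ => 1) - WithLp.toLp 2 (H *ᵥ fun _ => 1)‖ ≤ δ)
    (hw2δ : ‖WithLp.toLp 2 (H'ᵀ *ᵥ fun _ => 1) - WithLp.toLp 2 (Hᵀ *ᵥ fun _ => 1)‖ ≤ δ)
    {θ θ' : QuasiParams d k} (hθ' : IsAlgorithmOutput H' K' θ') (hθ : IsAlgorithmOutput H K θ) :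
    ∃ R ∈ Matrix.orthogonalGroup (Fin k) ℝ, (θ'.changeBasis R).Close ε θ := by
  obtain ⟨hr, P, Q, s, Ud, Vd, hsvd, hU, hV, hu, hv, hA⟩ := hθ
  obtain ⟨_, P', Q', s', Ud', Vd', hsvd', hU', hV', hu', hv', hA'⟩ := hθ'
  have hδ0 : 0 ≤ δ := (norm_nonneg _).trans hδ
  have hlast : k - 1 < d ^ n := by omega
  -- `sigma` counts from 1, the entries of `s` from 0.
  have hsk : s ⟨k - 1, hlast⟩ = σ := by rw [hσdef, hsvd.eq_singularValues]; rfl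
  have hlead : ∀ i : Fin k, σ ≤ s (Fin.castLE hr i) := fun i => by
    rw [← hsk]; exact hsvd.antitone (Fin.le_def.2 (by simp; omega))
  have hs0 : ∀ j : Fin (d ^ n), k ≤ j → s j = 0 := fun j hj =>
    hsvd.eq_zero_of_factorization A C hAC j hj
  have hD := scaledFactor_gram hr hsvd.left_orth hsvd.nonneg
  have hDV := scaledFactor_gram hr hsvd.right_orth hsvd.nonneg
  have hD' := scaledFactor_gram hr hsvd'.left_orth hsvd'.nonneg
  have hDV' := scaledFactor_gram hr hsvd'.right_orth hsvd'.nonneg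
  have B := hsvd.isBalancedFactor hr (fun i => (hσ.trans_le (hlead i)).ne') hU hV
  have hHfac : H = scaledFactor hr P s * (scaledFactor hr Q s)ᵀ := by
    have := hsvd.norm_sub_truncation_le hr le_rfl fun j hj => (hs0 j hj).le
    exact sub_eq_zero.1 (norm_le_zero_iff.1 this)
  have hσ1 : σ ≤ 1 := by
    have h1 := B.norm_left_le_one hH1
    have h2 : ‖(scaledFactor hr P s)ᵀ * scaledFactor hr P s‖ ≤ 1 := by
      rw [Matrix.l2_opNorm_transpose_mul_self]; exact mul_le_one₀ h1 (norm_nonneg _) h1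
    rw [hD, Matrix.l2_opNorm_diagonal] at h2
    have h3 := (pi_norm_le_iff_of_nonneg zero_le_one).1 h2 ⟨k - 1, by omega⟩
    exact (hlead _).trans ((le_abs_self _).trans h3)
  have hδσ : δ ≤ σ / 2 := by
    have : ε * σ ^ 4 ≤ 1 * σ := by
      gcongr
      exact pow_le_of_le_one hσ.le hσ1 (by norm_num)
    linarith
  have hlead' : ∀ i : Fin k, σ / 2 ≤ s' (Fin.castLE hr i) := fun i => by
    have h1 := hsvd.le_add_of_norm_sub_le hsvd' (by rwa [norm_sub_rev] : ‖H - H'‖ ≤ δ)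
      (Fin.castLE hr i)
    linarith [hlead i]
  have hσ2 : 0 < σ / 2 := by positivity
  have B' := hsvd'.isBalancedFactor hr (fun i => (hσ2.trans_le (hlead' i)).ne') hU' hV'
  -- The exact singular values vanish beyond the `k`-th, so by Weyl the discarded empirical ones are
  -- at most `δ`.
  have hres := hsvd'.norm_sub_truncation_le hr hδ0 fun j hj => by
    have h1 := hsvd'.le_add_of_norm_sub_le hsvd hδ j
    rwa [hs0 j hj, zero_add] at h1
  -- One bound serves all four pseudo-inverses: the retained singular values are at least `σ`, and
  -- at least `σ/2` after perturbation.
  have ha2 : √(2 / σ) ^ 2 = 2 / σ := Real.sq_sqrt (by positivity)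
  have ha0 := Real.sqrt_nonneg (2 / σ)
  have hi1 : σ⁻¹ ≤ √(2 / σ) ^ 2 := by
    rw [ha2, inv_eq_one_div]; gcongr; norm_num
  have hi2 : (σ / 2)⁻¹ ≤ √(2 / σ) ^ 2 := by rw [ha2, inv_div]
  obtain ⟨R, hR, h1, h2, h3⟩ := B.exists_rotation_realization B' hHfac hσ hσ1 hε1 hδ1 ha2 ha0
    (hU.norm_le hσ hlead hD ha0 hi1) (hV.norm_le hσ hlead hDV ha0 hi1)
    (hU'.norm_le hσ2 hlead' hD' ha0 hi2) (hV'.norm_le hσ2 hlead' hDV' ha0 hi2)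
    hH1 hH1' hδ hres (fun x => by
      rw [hD, dotProduct, dotProduct, Finset.mul_sum]
      refine Finset.sum_le_sum fun i _ => ?_
      rw [Matrix.mulVec_diagonal]
      nlinarith [hlead i, mul_self_nonneg (x i)]) K K' hK hK' hKδ (fun _ => 1) hw1 hw2 hw1δ hw2δ
  refine ⟨R, hR, ?_, ?_, fun j => ?_⟩
  · rw [hu, QuasiParams.changeBasis, hu']; exact h1
  · rw [hv, QuasiParams.changeBasis, hv']; exact h2
  · rw [hA]
    change ‖R⁻¹ * θ'.A j * R - _‖ ≤ ε
    rw [hA']; exact h3 j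

/-! ### Conditional independence and the rank of `H⁽⁰⁾` -/

/-- The times `-n, …, n` are the past times and the future times. -/
noncomputable def timeEquiv (n : ℕ) : Fin n ⊕ Fin (n + 1) ≃ Fin (2 * n + 1) :=
  Equiv.ofBijective (Sum.elim pastPos futurePos) <| by
    constructor
    · rintro (a | a) (b | b) h <;>
        simp only [Sum.elim_inl, Sum.elim_inr, pastPos, futurePos, Sum.inl.injEq,
          Sum.inr.injEq, Fin.ext_iff, reduceCtorEq] at h ⊢ <;> omega
    · intro t
      by_cases h : (t : ℕ) < n
      · exact ⟨Sum.inl ⟨n - 1 - t, by omega⟩, Fin.ext (by simp [pastPos]; omega)⟩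
      · exact ⟨Sum.inr ⟨t - n, by omega⟩, Fin.ext (by simp [futurePos]; omega)⟩

/-- A sequence over the times `-n, …, n` is a past and a future. -/
noncomputable def splitEquiv (n : ℕ) (α : Type*) :
    (Fin (2 * n + 1) → α) ≃ (Fin n → α) × (Fin (n + 1) → α) :=
  ((timeEquiv n).arrowCongr (Equiv.refl α)).symm.trans (Equiv.sumArrowEquivProdArrow _ _ α)

section Split

variable {n : ℕ} {α : Type*}

theorem splitEquiv_symm_past (x : (Fin n → α) × (Fin (n + 1) → α)) (m : Fin n) :
    (splitEquiv n α).symm x (pastPos m) = x.1 m :=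
  congrFun (congrArg Prod.fst ((splitEquiv n α).apply_symm_apply x)) m

theorem splitEquiv_symm_future (x : (Fin n → α) × (Fin (n + 1) → α)) (m : Fin (n + 1)) :
    (splitEquiv n α).symm x (futurePos m) = x.2 m :=
  congrFun (congrArg Prod.snd ((splitEquiv n α).apply_symm_apply x)) m

theorem splitEquiv_symm_of_lt {x y : (Fin n → α) × (Fin (n + 1) → α)} (h : x.1 = y.1)
    {t : Fin (2 * n + 1)} (ht : (t : ℕ) < n) :
    (splitEquiv n α).symm x t = (splitEquiv n α).symm y t := by
  have : t = pastPos ⟨n - 1 - t, by omega⟩ := Fin.ext (by simp [pastPos]; omega)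
  rw [this, splitEquiv_symm_past, splitEquiv_symm_past, h]

theorem splitEquiv_symm_of_ge {x y : (Fin n → α) × (Fin (n + 1) → α)} (h : x.2 = y.2)
    {t : Fin (2 * n + 1)} (ht : n ≤ (t : ℕ)) :
    (splitEquiv n α).symm x t = (splitEquiv n α).symm y t := by
  have : t = futurePos ⟨t - n, by omega⟩ := Fin.ext (by simp [futurePos]; omega)
  rw [this, splitEquiv_symm_future, splitEquiv_symm_future, h]

theorem splitEquiv_symm_of_le {x y : (Fin n → α) × (Fin (n + 1) → α)} (h : x.1 = y.1)
    (h0 : x.2 0 = y.2 0) {t : Fin (2 * n + 1)} (ht : (t : ℕ) ≤ n) :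
    (splitEquiv n α).symm x t = (splitEquiv n α).symm y t := by
  rcases ht.lt_or_eq with ht | ht
  · exact splitEquiv_symm_of_lt h ht
  · have : t = futurePos 0 := Fin.ext (by simp [futurePos, ht])
    rw [this, splitEquiv_symm_future, splitEquiv_symm_future, h0]

end Split

namespace HMM

variable {d k : ℕ} (M : HMM d k) {n : ℕ}

/-- The factors of the weight of the hidden path `x` and the outputs `w` before time `0`. -/
noncomputable def pastWeight (w : Word d (2 * n + 1)) (x : Fin (2 * n + 1) → Fin k) : ℝ :=
  M.pi (x 0) * (∏ t : Fin (2 * n), if (t : ℕ) < n then M.Q (x t.succ) (x t.castSucc) else 1) *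
    ∏ t : Fin (2 * n + 1), if (t : ℕ) < n then M.O (w t) (x t) else 1

/-- The factors of the weight of the hidden path `x` and the outputs `w` from time `0` on. -/
noncomputable def futureWeight (w : Word d (2 * n + 1)) (x : Fin (2 * n + 1) → Fin k) : ℝ :=
  (∏ t : Fin (2 * n), if (t : ℕ) < n then 1 else M.Q (x t.succ) (x t.castSucc)) *
    ∏ t : Fin (2 * n + 1), if (t : ℕ) < n then 1 else M.O (w t) (x t)

theorem table_eq_sum (w : Word d (2 * n + 1)) :
    M.table n w = ∑ x, M.pastWeight w x * M.futureWeight w x := by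
  refine Finset.sum_congr rfl fun x _ => ?_
  have h1 : ∏ t : Fin (2 * n), M.Q (x t.succ) (x t.castSucc)
      = (∏ t : Fin (2 * n), if (t : ℕ) < n then M.Q (x t.succ) (x t.castSucc) else 1) *
        ∏ t : Fin (2 * n), if (t : ℕ) < n then 1 else M.Q (x t.succ) (x t.castSucc) := by
    rw [← Finset.prod_mul_distrib]
    exact Finset.prod_congr rfl fun t _ => by split_ifs <;> simp
  have h2 : ∏ t : Fin (2 * n + 1), M.O (w t) (x t)
      = (∏ t : Fin (2 * n + 1), if (t : ℕ) < n then M.O (w t) (x t) else 1) *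
        ∏ t : Fin (2 * n + 1), if (t : ℕ) < n then 1 else M.O (w t) (x t) := by
    rw [← Finset.prod_mul_distrib]
    exact Finset.prod_congr rfl fun t _ => by split_ifs <;> simp
  rw [h1, h2, pastWeight, futureWeight]
  ring

/-- The last transition of the past ends in the state at position `n`, hence `≤` for states but `<`
for outputs. The state at position `n`, that is at time 0, is the only coordinate shared with the
future weight. -/
theorem pastWeight_congr {w w' : Word d (2 * n + 1)} {x x' : Fin (2 * n + 1) → Fin k}
    (hw : ∀ t : Fin (2 * n + 1), (t : ℕ) < n → w t = w' t)
    (hx : ∀ t : Fin (2 * n + 1), (t : ℕ) ≤ n → x t = x' t) :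
    M.pastWeight w x = M.pastWeight w' x' := by
  unfold pastWeight
  rw [hx 0 (Nat.zero_le n)]
  congr 1
  · refine congrArg _ (Finset.prod_congr rfl fun t _ => ?_)
    split_ifs with h
    · rw [hx t.succ (by simpa using h), hx t.castSucc (by simpa using h.le)]
    · rfl
  · refine Finset.prod_congr rfl fun t _ => ?_
    split_ifs with h
    · rw [hw t h, hx t h.le]
    · rfl

theorem futureWeight_congr {w w' : Word d (2 * n + 1)} {x x' : Fin (2 * n + 1) → Fin k}
    (hw : ∀ t : Fin (2 * n + 1), n ≤ (t : ℕ) → w t = w' t)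
    (hx : ∀ t : Fin (2 * n + 1), n ≤ (t : ℕ) → x t = x' t) :
    M.futureWeight w x = M.futureWeight w' x' := by
  unfold futureWeight
  congr 1
  · refine Finset.prod_congr rfl fun t _ => ?_
    split_ifs with h
    · rfl
    · rw [hx t.succ (by simp; omega), hx t.castSucc (by simp; omega)]
  · refine Finset.prod_congr rfl fun t _ => ?_
    split_ifs with h
    · rfl
    · rw [hw t (not_lt.1 h), hx t (not_lt.1 h)]

/-- The past and the future are independent given the hidden state at time `0`, so `H⁽⁰⁾` factors
through the hidden states. -/
theorem exists_hankelZero_factorization (l : Fin d) :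
    ∃ (A : Matrix (Word d n) (Fin k) ℝ) (C : Matrix (Fin k) (Word d n) ℝ),
      hankelZero (M.table n) = A * C := by
  classical
  let join := fun (b : Fin n → Fin d) c => (splitEquiv n (Fin d)).symm (b, c)
  let joinState := fun (b : Fin n → Fin k) c => (splitEquiv n (Fin k)).symm (b, c)
  -- The letter `l` and the constant paths fill coordinates on which the weights do not depend.
  let p : Word d n → (Fin n → Fin k) → Fin k → ℝ := fun b x i =>
    M.pastWeight (join b fun _ => l) (joinState x fun _ => i)
  let f : Word d (n + 1) → (Fin (n + 1) → Fin k) → ℝ := fun c x =>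
    M.futureWeight (join (fun _ => l) c) (joinState (fun _ => x 0) x)
  have htable : ∀ b c, M.table n (join b c) = ∑ x, ∑ z, p b x (z 0) * f c z := by
    intro b c
    rw [table_eq_sum, ← (splitEquiv n (Fin k)).symm.sum_comp, Fintype.sum_prod_type]
    refine Finset.sum_congr rfl fun x _ => Finset.sum_congr rfl fun z _ => ?_
    congr 1
    · exact M.pastWeight_congr (fun t ht => splitEquiv_symm_of_lt (x := (b, c)) (y := (b, fun _ => l)) rfl ht)
        (fun t ht => splitEquiv_symm_of_le (x := (x, z)) (y := (x, fun _ => z 0)) rfl rfl ht)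
    · exact M.futureWeight_congr
        (fun t ht => splitEquiv_symm_of_ge (x := (b, c)) (y := (fun _ => l, c)) rfl ht)
        (fun t ht => splitEquiv_symm_of_ge (x := (x, z)) (y := (fun _ => z 0, z)) rfl ht)
  refine ⟨Matrix.of fun a i => ∑ c : Word d (n + 1), if (∀ m : Fin n, c m.castSucc = a m) then
      ∑ z : Fin (n + 1) → Fin k, (if z 0 = i then f c z else 0) else 0,
    Matrix.of fun i b => ∑ x, p b x i, ?_⟩
  ext a b
  rw [hankelZero, Matrix.of_apply, ← (splitEquiv n (Fin d)).symm.sum_comp, Fintype.sum_prod_type,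
    Matrix.mul_apply]
  simp only [splitEquiv_symm_past, splitEquiv_symm_future, Matrix.of_apply]
  rw [Finset.sum_eq_single b]
  · simp only [implies_true, true_and, Finset.sum_mul]
    rw [Finset.sum_comm]
    refine Finset.sum_congr rfl fun c _ => ?_
    by_cases hc : ∀ m : Fin n, c m.castSucc = a m
    · simp only [hc, implies_true, if_true]
      refine (htable b c).trans ?_
      have h1 : ∑ i, (∑ z : Fin (n + 1) → Fin k, if z 0 = i then f c z else 0) * ∑ x, p b x i
          = ∑ z, f c z * ∑ x, p b x (z 0) := by
        simp only [Finset.sum_mul]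
        rw [Finset.sum_comm]
        simp only [ite_mul, zero_mul, Finset.sum_ite_eq, Finset.mem_univ, if_true]
      rw [Finset.sum_comm]
      refine Eq.trans ?_ h1.symm
      refine Finset.sum_congr rfl fun z _ => ?_
      rw [← Finset.sum_mul, mul_comm]
    · simp [hc]
  · intro b' _ hb
    refine Finset.sum_eq_zero fun c _ => if_neg fun h => hb (funext h.1)
  · simp

end HMM

/-! ### Norms of tables of joint masses -/

section JointMatrix

variable {W ι : Type*} [Fintype W] [Fintype ι] [DecidableEq ι]

/-- The table of the joint masses of `f` and `g` under the weights `q`. -/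
def jointMatrix (f g : W → ι) (q : W → ℝ) : Matrix ι ι ℝ :=
  Matrix.of fun a b => ∑ w, if f w = a ∧ g w = b then q w else 0

variable (f g : W → ι) (q q' : W → ℝ)

theorem jointMatrix_transpose : (jointMatrix f g q)ᵀ = jointMatrix g f q := by
  ext a b
  simp [jointMatrix, and_comm]

theorem jointMatrix_sub :
    jointMatrix f g q' - jointMatrix f g q = jointMatrix f g (fun w => q' w - q w) := by
  ext a b
  simp only [jointMatrix, Matrix.sub_apply, Matrix.of_apply, ← Finset.sum_sub_distrib]
  exact Finset.sum_congr rfl fun w _ => by split_ifs <;> simp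

theorem jointMatrix_mulVec_one (a : ι) :
    (jointMatrix f g q *ᵥ fun _ => 1) a = ∑ w, if f w = a then q w else 0 := by
  simp only [jointMatrix, Matrix.mulVec, dotProduct, Matrix.of_apply, mul_one]
  rw [Finset.sum_comm]
  refine Finset.sum_congr rfl fun w _ => ?_
  by_cases h : f w = a <;> simp [h]

/-- Source of the unit bounds: the entries of a joint table, or of its marginals, are masses of
total at most one. -/
theorem sum_sq_le_one_of_sum_le_one {τ : Type*} [Fintype τ] {x : τ → ℝ} (h0 : ∀ i, 0 ≤ x i)
    (h1 : ∑ i, x i ≤ 1) : ∑ i, x i ^ 2 ≤ 1 := by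
  refine le_trans (Finset.sum_le_sum fun i _ => ?_) h1
  have : x i ≤ 1 := (Finset.single_le_sum (fun j _ => h0 j) (Finset.mem_univ i)).trans h1
  exact pow_le_of_le_one (h0 i) this two_ne_zero

variable {q}

theorem norm_jointMatrix_mulVec_one_le (h0 : ∀ w, 0 ≤ q w) (h1 : ∑ w, q w ≤ 1) :
    ‖WithLp.toLp 2 (jointMatrix f g q *ᵥ fun _ => 1)‖ ≤ 1 := by
  refine le_of_sq_le_sq ?_ zero_le_one
  rw [norm_toLp_sq, one_pow]
  simp only [jointMatrix_mulVec_one]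
  refine sum_sq_le_one_of_sum_le_one
    (fun a => Finset.sum_nonneg fun w _ => by split_ifs <;> simp [h0]) ?_
  rw [Finset.sum_comm]
  simpa using h1

theorem norm_jointMatrix_le_one (h0 : ∀ w, 0 ≤ q w) (h1 : ∑ w, q w ≤ 1) :
    ‖jointMatrix f g q‖ ≤ 1 := by
  refine Matrix.l2_opNorm_le_of_sum_sq_le zero_le_one ?_
  rw [one_pow, ← Fintype.sum_prod_type']
  refine sum_sq_le_one_of_sum_le_one
    (fun a => Finset.sum_nonneg fun w _ => by split_ifs <;> simp [h0]) ?_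
  rw [Fintype.sum_prod_type]
  have : ∀ a, ∑ b, jointMatrix f g q a b = ∑ w, if f w = a then q w else 0 := fun a => by
    rw [← jointMatrix_mulVec_one f g]; simp [Matrix.mulVec, dotProduct]
  simp only [this]
  rw [Finset.sum_comm]
  simpa using h1

theorem norm_le_card_mul_of_entry_le {A : Matrix ι ι ℝ} {t : ℝ} (ht : 0 ≤ t)
    (h : ∀ a b, |A a b| ≤ t) : ‖A‖ ≤ Fintype.card ι * t := by
  refine Matrix.l2_opNorm_le_of_sum_sq_le (by positivity) ?_
  calc ∑ i, ∑ j, A i j ^ 2 ≤ ∑ _i : ι, ∑ _j : ι, t ^ 2 :=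
        Finset.sum_le_sum fun i _ => Finset.sum_le_sum fun j _ => sq_le_sq.2 (by
          rw [abs_of_nonneg ht]; exact h i j)
    _ = (Fintype.card ι * t) ^ 2 := by simp; ring

/-- The square root of the cardinality would do; the cruder factor gives vectors the same error `δ =
dⁿ t` as matrices. -/
theorem norm_toLp_le_card_mul_of_entry_le {x : ι → ℝ} {t : ℝ} (ht : 0 ≤ t)
    (h : ∀ a, |x a| ≤ t) : ‖WithLp.toLp 2 x‖ ≤ Fintype.card ι * t := by
  refine le_of_sq_le_sq ?_ (by positivity)
  rw [norm_toLp_sq]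
  calc ∑ i, x i ^ 2 ≤ ∑ _i : ι, t ^ 2 :=
        Finset.sum_le_sum fun i _ => sq_le_sq.2 (by rw [abs_of_nonneg ht]; exact h i)
    _ = Fintype.card ι * t ^ 2 := by simp
    _ ≤ (Fintype.card ι : ℝ) ^ 2 * t ^ 2 := by
        gcongr
        exact_mod_cast Nat.le_self_pow two_ne_zero (Fintype.card ι)
    _ = _ := by ring

end JointMatrix

/-! ### Hankel matrices as joint tables -/

section Windows

variable {d n : ℕ}

/-- The outputs `(y_{-1}, …, y_{-n})`. -/
def pastWord (w : Word d (2 * n + 1)) : Word d n := fun m => w (pastPos m)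

/-- The outputs `(y_0, …, y_{n-1})`. -/
def futureWord (w : Word d (2 * n + 1)) : Word d n := fun m => w (futurePos m.castSucc)

/-- The outputs `(y_1, …, y_n)`. -/
def nextWord (w : Word d (2 * n + 1)) : Word d n := fun m => w (futurePos m.succ)

theorem hankelZero_eq_jointMatrix (p : Word d (2 * n + 1) → ℝ) :
    hankelZero p = jointMatrix futureWord pastWord p := by
  ext a b
  simp only [hankelZero, jointMatrix, Matrix.of_apply, funext_iff, futureWord, pastWord, and_comm]

theorem hankel_eq_jointMatrix (p : Word d (2 * n + 1) → ℝ) (j : Fin d) :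
    hankel p j = jointMatrix nextWord pastWord fun w => if w (futurePos 0) = j then p w else 0 := by
  ext a b
  simp only [hankel, jointMatrix, Matrix.of_apply, funext_iff, nextWord, pastWord]
  refine Finset.sum_congr rfl fun w _ => ?_
  rw [← ite_and]
  exact if_congr (by tauto) rfl rfl

/-- The sets of strings whose probabilities are the entries of `H⁽⁰⁾`, of the `H⁽ʲ⁾`, and of the
row and column sums of `H⁽⁰⁾`. -/
def windowEvent :
    (Word d n × Word d n) ⊕ (Fin d × Word d n × Word d n) ⊕ Word d n ⊕ Word d n →
      Finset (Word d (2 * n + 1))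
  | .inl (a, b) => {w | futureWord w = a ∧ pastWord w = b}
  | .inr (.inl (j, a, b)) =>
      {w | (nextWord w = a ∧ pastWord w = b) ∧ w (futurePos 0) = j}
  | .inr (.inr (.inl a)) => {w | futureWord w = a}
  | .inr (.inr (.inr b)) => {w | pastWord w = b}

end Windows

/-! ### Concentration of empirical probabilities -/

section Hoeffding

variable {d N T : ℕ}

theorem sum_empirical (y : Fin T → Word d N) (S : Finset (Word d N)) :
    ∑ w ∈ S, empirical y w = (∑ i, if y i ∈ S then (1 : ℝ) else 0) / T := by
  simp only [empirical]
  rw [← Finset.sum_div]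
  congr 1
  have : ∀ w, (Fintype.card {i : Fin T // y i = w} : ℝ) = ∑ i, if y i = w then 1 else 0 :=
    fun w => by rw [Fintype.card_subtype]; simp
  simp only [this]
  rw [Finset.sum_comm]
  simp

theorem empirical_nonneg (y : Fin T → Word d N) (w : Word d N) : 0 ≤ empirical y w := by
  unfold empirical; positivity

theorem sum_empirical_univ (hT : 0 < T) (y : Fin T → Word d N) : ∑ w, empirical y w = 1 := by
  have : (T : ℝ) ≠ 0 := by positivity
  rw [sum_empirical]; simp [this]

/-- Hoeffding's inequality for the empirical probability of a set of strings. -/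
theorem measureReal_empirical_deviation_le {Ω : Type*} [MeasurableSpace Ω] (μ : Measure Ω)
    [IsProbabilityMeasure μ] (hT : 0 < T) (Y : Fin T → Ω → Word d N)
    (hY : ∀ i, Measurable (Y i)) (hind : iIndepFun Y μ) {p : Word d N → ℝ}
    (hp : ∀ i w, μ.real {ω | Y i ω = w} = p w) (S : Finset (Word d N)) {t : ℝ} (ht : 0 ≤ t) :
    μ.real {ω | t ≤ |∑ w ∈ S, (empirical (fun i => Y i ω) w - p w)|}
      ≤ 2 * Real.exp (-2 * T * t ^ 2) := by
  have hT' : (0 : ℝ) < T := by exact_mod_cast hT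
  let ind : Word d N → ℝ := fun w => if w ∈ S then 1 else 0
  have hind_meas : Measurable ind := measurable_of_countable _
  set P := ∑ w ∈ S, p w with hP
  have hmean : ∀ i, μ[ind ∘ Y i] = P := by
    intro i
    have h1 : ind ∘ Y i = fun ω => ∑ w ∈ S, ({ω | Y i ω = w}.indicator (fun _ => (1 : ℝ)) ω) := by
      ext ω
      simp [ind, Set.indicator_apply]
    have hm : ∀ w, MeasurableSet {ω | Y i ω = w} := fun w => hY i (measurableSet_singleton w)
    rw [h1, integral_finsetSum _ fun w _ => (integrable_const (1 : ℝ)).indicator (hm w)]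
    refine Finset.sum_congr rfl fun w _ => ?_
    rw [integral_indicator_const _ (hm w), hp]; simp
  -- Hoeffding's lemma: a variable with values in `[0, 1]` has variance proxy `1/4`.
  have hsub : ∀ i, HasSubgaussianMGF (fun ω => ind (Y i ω) - P) ((‖(1 : ℝ) - 0‖₊ / 2) ^ 2) μ := by
    intro i
    have := hasSubgaussianMGF_of_mem_Icc (μ := μ) (X := ind ∘ Y i) (a := 0) (b := 1)
      (hind_meas.comp (hY i)).aemeasurable
      (ae_of_all _ fun ω => by simp only [ind, Function.comp]; split_ifs <;> simp)
    rwa [hmean] at this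
  have hindep : iIndepFun (fun i ω => ind (Y i ω) - P) μ :=
    hind.comp (fun _ w => ind w - P) fun _ => measurable_of_countable _
  have hindep' : iIndepFun (fun i ω => -(ind (Y i ω) - P)) μ :=
    hind.comp (fun _ w => -(ind w - P)) fun _ => measurable_of_countable _
  have hTt : 0 ≤ T * t := by positivity
  have b1 := HasSubgaussianMGF.measure_sum_ge_le_of_iIndepFun hindep (s := Finset.univ)
    (fun i _ => hsub i) hTt
  have b2 := HasSubgaussianMGF.measure_sum_ge_le_of_iIndepFun hindep' (s := Finset.univ)
    (fun i _ => (hsub i).neg) hTt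
  -- `(T t)² / (2 · T/4) = 2 T t²`.
  have hexp : -(T * t) ^ 2 / (2 * ((∑ _i : Fin T, (‖(1 : ℝ) - 0‖₊ / 2) ^ 2 : NNReal) : ℝ))
      = -2 * T * t ^ 2 := by
    simp only [sub_zero, nnnorm_one, Finset.sum_const, Finset.card_univ, Fintype.card_fin,
      nsmul_eq_mul]
    push_cast
    field_simp
  rw [hexp] at b1 b2
  have hdev : ∀ ω, T * ∑ w ∈ S, (empirical (fun i => Y i ω) w - p w)
      = ∑ i, (ind (Y i ω) - P) := by
    intro ω
    rw [Finset.sum_sub_distrib, sum_empirical, Finset.sum_sub_distrib, mul_sub,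
      mul_div_cancel₀ _ hT'.ne']
    simp [ind, hP]
  calc μ.real {ω | t ≤ |∑ w ∈ S, (empirical (fun i => Y i ω) w - p w)|}
      ≤ μ.real ({ω | T * t ≤ ∑ i, (ind (Y i ω) - P)} ∪
          {ω | T * t ≤ ∑ i, -(ind (Y i ω) - P)}) := by
        refine measureReal_mono fun ω hω => ?_
        rcases le_abs.1 (Set.mem_ofPred.1 hω) with h | h
        · left
          rw [Set.mem_ofPred, ← hdev]
          exact mul_le_mul_of_nonneg_left h hT'.le
        · right
          rw [Set.mem_ofPred, Finset.sum_neg_distrib, ← hdev, ← mul_neg]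
          exact mul_le_mul_of_nonneg_left h hT'.le
    _ ≤ _ := (measureReal_union_le _ _).trans (by linarith)

end Hoeffding

/-! ### Assembly: deviations, sample size, main theorem -/

/-- If all window events have empirical probabilities near the exact ones, the outputs of the
spectral realization algorithm are close up to a rotation. -/
theorem HMM.exists_changeBasis_close_of_deviation {d k n : ℕ} (l : Fin d) (hk : 1 ≤ k)
    (M : HMM d k) {σ ε t : ℝ} (hσdef : σ = sigma (hankelZero (M.table n)) k) (hσ : 0 < σ)
    (hε1 : ε ≤ 1) (ht0 : 0 ≤ t) (ht : (d : ℝ) ^ n * t ≤ ε * σ ^ 4 / 600)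
    (hp0 : ∀ w, 0 ≤ M.table n w) (hp1 : ∑ w, M.table n w = 1)
    {q : Word d (2 * n + 1) → ℝ} (hq0 : ∀ w, 0 ≤ q w) (hq1 : ∑ w, q w = 1)
    (hdev : ∀ e, |∑ w ∈ windowEvent e, (q w - M.table n w)| ≤ t)
    {θ θ' : QuasiParams d k} (hθ' : IsAlgorithmOutput (hankelZero q) (hankel q) θ')
    (hθ : IsAlgorithmOutput (hankelZero (M.table n)) (hankel (M.table n)) θ) :
    ∃ R ∈ Matrix.orthogonalGroup (Fin k) ℝ, (θ'.changeBasis R).Close ε θ := by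
  obtain ⟨A, C, hAC⟩ := M.exists_hankelZero_factorization (n := n) l
  have hcard : (Fintype.card (Word d n) : ℝ) = (d : ℝ) ^ n := by simp
  have hite0 : ∀ {p : Word d (2 * n + 1) → ℝ}, (∀ w, 0 ≤ p w) → ∀ (j : Fin d) w,
      0 ≤ if w (futurePos 0) = j then p w else 0 := fun h j w => by split_ifs <;> simp [h]
  have hite1 : ∀ {p : Word d (2 * n + 1) → ℝ}, (∀ w, 0 ≤ p w) → ∑ w, p w = 1 → ∀ j : Fin d,
      ∑ w, (if w (futurePos 0) = j then p w else 0) ≤ 1 := fun h h1 j => by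
    rw [← h1]
    exact Finset.sum_le_sum fun w _ => by split_ifs <;> simp [h]
  have hsub : ∀ j : Fin d, (fun w => (if w (futurePos 0) = j then q w else 0) -
      if w (futurePos 0) = j then M.table n w else 0)
      = fun w => if w (futurePos 0) = j then q w - M.table n w else 0 := fun j => by
    ext w; split_ifs <;> simp
  refine exists_changeBasis_close hk hσdef hσ hε1 ht A C hAC ?_ ?_ ?_ (fun j => ?_) (fun j => ?_)
    (fun j => ?_) ?_ ?_ ?_ ?_ hθ' hθ
  · rw [hankelZero_eq_jointMatrix]; exact norm_jointMatrix_le_one _ _ hp0 hp1.le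
  · rw [hankelZero_eq_jointMatrix]; exact norm_jointMatrix_le_one _ _ hq0 hq1.le
  · rw [hankelZero_eq_jointMatrix, hankelZero_eq_jointMatrix, jointMatrix_sub, ← hcard]
    refine norm_le_card_mul_of_entry_le ht0 fun a b => ?_
    have := hdev (.inl (a, b))
    rwa [windowEvent, Finset.sum_filter] at this
  · rw [hankel_eq_jointMatrix]
    exact norm_jointMatrix_le_one _ _ (hite0 hp0 j) (hite1 hp0 hp1 j)
  · rw [hankel_eq_jointMatrix]
    exact norm_jointMatrix_le_one _ _ (hite0 hq0 j) (hite1 hq0 hq1 j)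
  · rw [hankel_eq_jointMatrix, hankel_eq_jointMatrix, jointMatrix_sub, ← hcard, hsub]
    refine norm_le_card_mul_of_entry_le ht0 fun a b => ?_
    have := hdev (.inr (.inl (j, a, b)))
    rw [windowEvent, Finset.sum_filter] at this
    simpa only [jointMatrix, Matrix.of_apply, ← ite_and] using this
  · rw [hankelZero_eq_jointMatrix]
    exact norm_jointMatrix_mulVec_one_le _ _ hp0 hp1.le
  · rw [hankelZero_eq_jointMatrix, jointMatrix_transpose]
    exact norm_jointMatrix_mulVec_one_le _ _ hp0 hp1.le
  · rw [hankelZero_eq_jointMatrix, hankelZero_eq_jointMatrix, ← WithLp.toLp_sub,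
      ← Matrix.sub_mulVec, jointMatrix_sub, ← hcard]
    refine norm_toLp_le_card_mul_of_entry_le ht0 fun a => ?_
    -- Each marginal has its own event: summing the entry bounds over a row would lose a factor
    -- `dⁿ`.
    have := hdev (.inr (.inr (.inl a)))
    rw [windowEvent, Finset.sum_filter] at this
    rwa [jointMatrix_mulVec_one]
  · rw [hankelZero_eq_jointMatrix, hankelZero_eq_jointMatrix, jointMatrix_transpose,
      jointMatrix_transpose, ← WithLp.toLp_sub, ← Matrix.sub_mulVec, jointMatrix_sub, ← hcard]
    refine norm_toLp_le_card_mul_of_entry_le ht0 fun a => ?_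
    have := hdev (.inr (.inr (.inr a)))
    rw [windowEvent, Finset.sum_filter] at this
    rwa [jointMatrix_mulVec_one]

/-- Rounding the logarithm up costs at most one factor `d`, and the 2 in the half window squares the
result. -/
theorem pow_halfWindow_le {d k : ℕ} (hd : 2 ≤ d) (hk : 1 ≤ k) :
    (d : ℝ) ^ halfWindow d k ≤ (d : ℝ) ^ 2 * (k : ℝ) ^ 2 := by
  have hd1 : (1 : ℝ) < d := by exact_mod_cast hd
  have hk1 : (1 : ℝ) ≤ k := by exact_mod_cast hk
  have hd0 : (0 : ℝ) < d := by linarith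
  have h1 : (d : ℝ) ^ ⌈Real.logb d k⌉₊ ≤ d * k := by
    have h2 := (Nat.ceil_lt_add_one (Real.logb_nonneg hd1 hk1)).le
    calc (d : ℝ) ^ ⌈Real.logb d k⌉₊ = (d : ℝ) ^ ((⌈Real.logb d k⌉₊ : ℕ) : ℝ) :=
          (Real.rpow_natCast _ _).symm
      _ ≤ (d : ℝ) ^ (Real.logb d k + 1) := Real.rpow_le_rpow_of_exponent_le hd1.le h2
      _ = d * k := by
          rw [Real.rpow_add hd0, Real.rpow_logb hd0 hd1.ne' (by linarith), Real.rpow_one, mul_comm]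
  calc (d : ℝ) ^ halfWindow d k = ((d : ℝ) ^ ⌈Real.logb d k⌉₊) ^ 2 := by
        rw [halfWindow, mul_comm, pow_mul]
    _ ≤ (d * k) ^ 2 := by gcongr
    _ = _ := by ring

/-- The sample size makes the union bound over the window events at most `η`. -/
theorem union_bound_le {d k T D σ ε η : ℝ} (hd : 2 ≤ d) (hk : 1 ≤ k) (hD1 : 1 ≤ D)
    (hD : D ≤ d ^ 2 * k ^ 2) (hσ : 0 < σ) (hε : 0 < ε) (hε1 : ε ≤ 1) (hη : 0 < η) (hη1 : η ≤ 1)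
    (hT : 540000 * k ^ 6 * d ^ 4 / (ε ^ 4 * σ ^ 8) * Real.log (2 * k ^ 4 * d ^ 2 / η) ≤ T) :
    (D * D + d * (D * D) + D + D) *
      (2 * Real.exp (-2 * T * (ε * σ ^ 4 / (600 * D)) ^ 2)) ≤ η := by
  set q := 2 * k ^ 4 * d ^ 2 / η with hq
  have hk4 : 1 ≤ k ^ 4 := one_le_pow₀ hk
  have hq1 : 1 ≤ q := by
    rw [hq, one_le_div hη]; nlinarith
  have hq0 : 0 < q := by linarith
  set L := Real.log q
  have hL : 0 ≤ L := Real.log_nonneg hq1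
  have hDD : D ^ 2 ≤ d ^ 4 * k ^ 4 := by
    calc D ^ 2 ≤ (d ^ 2 * k ^ 2) ^ 2 := by gcongr
      _ = _ := by ring
  -- The aim is `q⁻³` for the exponential: the events number up to order `d⁵ k⁴` while `q` carries
  -- only `d²`, so the cube is needed. Here `3 = 2 · 540000 / 360000`, and the spare factor `k²/ε² ≥
  -- 1` of the sample size is dropped.
  have hmain : 3 * L ≤ 2 * T * (ε * σ ^ 4 / (600 * D)) ^ 2 := by
    have e1 : (ε * σ ^ 4 / (600 * D)) ^ 2 = ε ^ 2 * σ ^ 8 / (360000 * D ^ 2) := by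
      rw [div_pow]; ring
    rw [e1]
    calc 3 * L ≤ 3 * L * (k ^ 2 / ε ^ 2) := by
          refine le_mul_of_one_le_right (by positivity) ?_
          rw [one_le_div (by positivity)]
          exact pow_le_pow_left₀ hε.le (hε1.trans hk) 2
      _ = 2 * (540000 * k ^ 6 * d ^ 4 / (ε ^ 4 * σ ^ 8) * L) *
          (ε ^ 2 * σ ^ 8 / (360000 * (d ^ 4 * k ^ 4))) := by field_simp; ring
      _ ≤ 2 * T * (ε ^ 2 * σ ^ 8 / (360000 * D ^ 2)) := by
          have hT0 : 0 ≤ T := le_trans (by positivity) hT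
          refine mul_le_mul (by linarith) ?_ (by positivity) (by positivity)
          gcongr
  have hexp : Real.exp (-2 * T * (ε * σ ^ 4 / (600 * D)) ^ 2) ≤ (q ^ 3)⁻¹ := by
    calc Real.exp (-2 * T * (ε * σ ^ 4 / (600 * D)) ^ 2) ≤ Real.exp (-(3 * L)) :=
          Real.exp_le_exp.2 (by linarith)
      _ = (q ^ 3)⁻¹ := by
          rw [Real.exp_neg, show (3 : ℝ) * L = ((3 : ℕ) : ℝ) * L by norm_num, Real.exp_nat_mul,
            Real.exp_log hq0]
  have hcount : D * D + d * (D * D) + D + D ≤ 4 * (d ^ 5 * k ^ 4) := by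
    have h1 : D ≤ D * D := le_mul_of_one_le_left (by linarith) hD1
    have h2 : 2 * (D * D) ≤ d * (D * D) := by gcongr
    have h3 : d * (D * D) ≤ d * (d ^ 4 * k ^ 4) := by rw [← sq]; gcongr
    have h4 : 0 ≤ d * (d ^ 4 * k ^ 4) := by positivity
    nlinarith
  calc (D * D + d * (D * D) + D + D) * (2 * Real.exp (-2 * T * (ε * σ ^ 4 / (600 * D)) ^ 2))
      ≤ 4 * (d ^ 5 * k ^ 4) * (2 * (q ^ 3)⁻¹) := by gcongr
    _ = η ^ 3 / (d * k ^ 8) := by rw [hq]; field_simp; norm_num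
    _ ≤ η ^ 3 := div_le_self (by positivity) (by
        have : 1 ≤ k ^ 8 := one_le_pow₀ hk
        nlinarith)
    _ ≤ η := pow_le_of_le_one hη.le hη1 (by norm_num)

theorem theorem2 :
    ∃ C : ℝ, 0 < C ∧
      ∀ (d k n : ℕ), 2 ≤ d → 1 ≤ k → n = halfWindow d k →
      ∀ (M : HMM d k) (σ : ℝ), σ = sigma (hankelZero (M.table n)) k → 0 < σ →
      ∀ (ε η : ℝ), 0 < ε → ε ≤ 1 → 0 < η →
      ∀ (T : ℕ),
        C * (k : ℝ) ^ 6 * (d : ℝ) ^ 4 / (ε ^ 4 * σ ^ 8)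
          * Real.log (2 * (k : ℝ) ^ 4 * (d : ℝ) ^ 2 / η) ≤ (T : ℝ) →
      ∀ {Ω : Type*} [MeasurableSpace Ω] (μ : Measure Ω) [IsProbabilityMeasure μ]
        (Y : Fin T → Ω → Word d (2 * n + 1)),
        (∀ i, Measurable (Y i)) → iIndepFun Y μ →
        (∀ i w, μ.real {ω | Y i ω = w} = M.table n w) →
        1 - η ≤ μ.real {ω |
          ∀ θhat θtilde : QuasiParams d k,
            IsAlgorithmOutput (hankelZero (empirical fun i => Y i ω))
              (hankel (empirical fun i => Y i ω)) θhat →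
            IsAlgorithmOutput (hankelZero (M.table n)) (hankel (M.table n)) θtilde →
            ∃ R ∈ Matrix.orthogonalGroup (Fin k) ℝ, (θhat.changeBasis R).Close ε θtilde} := by
  refine ⟨540000, by norm_num, ?_⟩
  intro d k n hd hk hn M σ hσdef hσ ε η hε hε1 hη T hT Ω _ μ _ Y hY hind hp
  -- For `η > 1` the claim is trivial. Otherwise the logarithm is positive, hence so is `T`, as is
  -- needed for the empirical probabilities to sum to one.
  rcases lt_or_ge 1 η with hη1 | hη1
  · exact le_trans (by linarith) measureReal_nonneg
  have hd' : (2 : ℝ) ≤ d := by exact_mod_cast hd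
  have hk' : (1 : ℝ) ≤ k := by exact_mod_cast hk
  set D : ℝ := (d : ℝ) ^ n with hDdef
  have hD1 : 1 ≤ D := one_le_pow₀ (by linarith)
  have hD : D ≤ (d : ℝ) ^ 2 * (k : ℝ) ^ 2 := by rw [hDdef, hn]; exact pow_halfWindow_le hd hk
  have hTpos : 0 < T := by
    have hq : 1 < 2 * (k : ℝ) ^ 4 * (d : ℝ) ^ 2 / η := by
      rw [one_lt_div hη]
      have : 1 ≤ (k : ℝ) ^ 4 := one_le_pow₀ hk'
      nlinarith
    have hlog := Real.log_pos hq
    have hd0 : (0 : ℝ) < d := by linarith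
    have hk0 : (0 : ℝ) < k := by linarith
    have h : (0 : ℝ) < T := lt_of_lt_of_le (mul_pos (by positivity) hlog) hT
    exact_mod_cast h
  -- As `T > 0` there is a sample, and the table, being its law, is a probability vector.
  have hp0 : ∀ w, 0 ≤ M.table n w := fun w => by
    rw [← hp ⟨0, hTpos⟩ w]; exact measureReal_nonneg
  have hp1 : ∑ w, M.table n w = 1 := by
    have h1 := sum_measureReal_preimage_singleton (μ := μ) (f := Y ⟨0, hTpos⟩) Finset.univ
      fun w _ => hY _ (measurableSet_singleton w)
    have h2 : Y ⟨0, hTpos⟩ ⁻¹' ((Finset.univ : Finset (Word d (2 * n + 1))) : Set _)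
        = Set.univ := by simp
    rw [h2, probReal_univ] at h1
    rw [← h1]
    exact Finset.sum_congr rfl fun w _ => (hp ⟨0, hTpos⟩ w).symm
  set t := ε * σ ^ 4 / (600 * D) with htdef
  have ht0 : 0 ≤ t := by positivity
  have ht : D * t ≤ ε * σ ^ 4 / 600 := le_of_eq (by rw [htdef]; field_simp)
  set bad : Set Ω := ⋃ e, {ω | t ≤ |∑ w ∈ windowEvent (d := d) (n := n) e,
    (empirical (fun i => Y i ω) w - M.table n w)|} with hbad
  have hbadle : μ.real bad ≤ η := by
    refine (measureReal_iUnion_fintype_le _).trans ((Finset.sum_le_sum fun e _ =>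
      measureReal_empirical_deviation_le μ hTpos Y hY hind hp (windowEvent e) ht0).trans ?_)
    refine le_trans (le_of_eq ?_) (union_bound_le hd' hk' hD1 hD hσ hε hε1 hη hη1 hT)
    rw [Finset.sum_const, Finset.card_univ, nsmul_eq_mul]
    simp only [Fintype.card_sum, Fintype.card_prod, Fintype.card_fin, Fintype.card_fun]
    push_cast
    ring
  -- Subadditivity and monotonicity suffice, so neither `bad` nor the event of the theorem has to be
  -- shown measurable.
  have hcover : 1 ≤ μ.real badᶜ + μ.real bad := by
    have h := measureReal_union_le (μ := μ) badᶜ bad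
    rwa [Set.compl_union_self, probReal_univ] at h
  refine le_trans (by linarith : 1 - η ≤ μ.real badᶜ) (measureReal_mono fun ω hω => ?_)
  intro θhat θtilde hhat htilde
  refine M.exists_changeBasis_close_of_deviation ⟨0, by omega⟩ hk hσdef hσ hε1 ht0 ht hp0 hp1
    (empirical_nonneg _) (sum_empirical_univ hTpos _) (fun e => ?_) hhat htilde
  by_contra hcon
  exact hω (Set.mem_iUnion.2 ⟨e, (not_le.1 hcon).le⟩)
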